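/- For real $a\notin\{-1,-2,\dots\}$ let $H_a=H_a^{(1)}=\psi(a+1)+\gamma$ and, for integers $s\ge 2$, $H_a^{(s)}=\frac{(-1)^{s-1}}{(s-1)!}\bigl(\psi^{(s-1)}(a+1)-\psi^{(s-1)}(1)\bigr)$, where $\psi=\Gamma'/\Gamma$ and $\gamma$ is Euler's constant; $\zeta$ is the Riemann zeta function. Let $k,r,m$ be positive integers with $k>r$ and let $p\in\{0,1\}$. For real $\alpha>k$ consider the five series $$W^{(1)}_{k,r}(p,m,\alpha)=\sum_{n=1}^\infty\frac{H_{n+\alpha}^{(m)}}{n^p\binom{n+k+r}{k}},\qquad W^{(2)}_{k,r}(p,1,\alpha)=\sum_{n=1}^\infty\frac{H_{n+\alpha}^{2}}{n^p\binom{n+k+r}{k}},\qquad W^{(3)}_{k,r}(p,1,\alpha)=\sum_{n=1}^\infty\frac{H_{n+\alpha}^{3}}{n^p\binom{n+k+r}{k}},$$ $$\sum_{n=1}^\infty\frac{H_{n+\alpha}H_{n+\alpha}^{(2)}}{n^p\binom{n+k+r}{k}},\qquad \sum_{n=1}^\infty\frac{H_{n+\alpha}^2H_{n+\alpha}^{(2)}}{n^p\binom{n+k+r}{k}}.$$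 Each of them can be expressed in terms of shifted harmonic numbers and zeta values, in the following sense. (i) For each of the five series there is a polynomial $P$ with rational coefficients, not depending on $\alpha$, in finitely many of the quantities $H_{\alpha-i}^{(s)}$ ($0\le i\le k+r$, $s\ge 1$) and $\zeta(t)$ ($t\ge 2$), such that for every real $\alpha>k$ that is not an integer smaller than $k+r$ (so that all these quantities are defined) the series converges and its sum is the value of $P$. (ii) For every integer $\alpha>k$ each of the five series converges, and its sum is a polynomial with rational coefficients in finitely many of the zeta values $\zeta(t)$, $t\ge2$ (the harmonic numbers of integer index being rational). -/

import Mathlib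

namespace ShiftedHarmonic

/-- The digamma function `ψ(x) = Γ'(x) / Γ(x)` on the real line (used only off its poles
`0, -1, -2, …`). -/
noncomputable def digamma : ℝ → ℝ := logDeriv Real.Gamma

/-- The generalized shifted harmonic number `H_a^{(m)}`, for `m ≥ 1` and real `a ≠ -1, -2, …`:
`H_a^{(1)} = ψ(a + 1) + γ`, and for `m ≥ 2`
`H_a^{(m)} = (-1)^(m-1) / (m-1)! * (ψ^{(m-1)}(a + 1) - ψ^{(m-1)}(1))`. -/
noncomputable def H (m : ℕ) (a : ℝ) : ℝ :=
  if m = 1 then digamma (a + 1) + Real.eulerMascheroniConstant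
  else (-1) ^ (m - 1) / ((m - 1).factorial : ℝ) *
    (iteratedDeriv (m - 1) digamma (a + 1) - iteratedDeriv (m - 1) digamma 1)

/-- The zeta value `ζ(s)` at an integer `s ≥ 2`, as a real number. -/
noncomputable def zetaValue (s : ℕ) : ℝ := (riemannZeta (s : ℂ)).re

/-- The denominator `n^p * C(n + k + r, k)`. -/
noncomputable def denom (p k r n : ℕ) : ℝ := (n : ℝ) ^ p * ((n + k + r).choose k : ℝ)

/-- The `n`-th term of the series `W^{(l)}_{k,r}(p, m, α) = ∑_{n ≥ 1} (H_{n+α}^{(m)})^l /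
(n^p C(n+k+r, k))`. -/
noncomputable def WTerm (l k r p m : ℕ) (α : ℝ) (n : ℕ) : ℝ :=
  H m (n + α) ^ l / denom p k r n

/-- The `n`-th term of the mixed series
`∑_{n ≥ 1} H_{n+α}^l H_{n+α}^{(2)} / (n^p C(n+k+r, k))`. -/
noncomputable def mixedTerm (l k r p : ℕ) (α : ℝ) (n : ℕ) : ℝ :=
  H 1 (n + α) ^ l * H 2 (n + α) / denom p k r n

/-- The real numbers that may enter a closed form at the parameter `α`: the shifted harmonic
numbers `H_{α-i}^{(s)}` with `0 ≤ i ≤ N` and `s ≥ 1`, and the zeta values `ζ(t)` with `t ≥ 2`. -/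
noncomputable def generator (N : ℕ) (α : ℝ) : (Fin (N + 1) × ℕ) ⊕ ℕ → ℝ :=
  Sum.elim (fun q => H (q.2 + 1) (α - ((q.1 : ℕ) : ℝ))) (fun t => zetaValue (t + 2))

/-- The series `∑_{n ≥ 1} f α n` can, for `α > k`, be expressed in terms of shifted harmonic numbers
and zeta values, as a rational linear combination of products of such numbers.

* One and the same expression `P`, a polynomial with rational coefficients that does not depend on
  `α`, gives the sum for all real `α > k` at which the numbers `H_{α-i}^{(s)}`, `0 ≤ i ≤ k + r`, are
  all defined, that is, for which `α` is not an integer smaller than `k + r`.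
* At every integer `α > k` (including the integers smaller than `k + r`, where some `H_{α-i}^{(s)}`
  has a pole) the sum is a polynomial with rational coefficients in zeta values alone; there the
  shifted harmonic numbers `H_{α+j}^{(s)}`, `j ≥ 0`, are ordinary harmonic numbers, hence rational,
  and are absorbed in the coefficients.

In both cases the convergence of the series is part of the claim. -/
def HasClosedForm (k r : ℕ) (f : ℝ → ℕ → ℝ) : Prop :=
  (∃ P : MvPolynomial ((Fin (k + r + 1) × ℕ) ⊕ ℕ) ℚ,
    ∀ α : ℝ, (k : ℝ) < α → (∀ j : ℕ, j < k + r → α ≠ (j : ℝ)) →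
      HasSum (fun n : ℕ => f α (n + 1)) (MvPolynomial.aeval (generator (k + r) α) P)) ∧
  (∀ a : ℕ, k < a → ∃ Q : MvPolynomial ℕ ℚ,
    HasSum (fun n : ℕ => f (a : ℝ) (n + 1))
      (MvPolynomial.aeval (fun t : ℕ => zetaValue (t + 2)) Q))

end ShiftedHarmonic

/-! Write `ΔF(y) = F(y) - F(y-1)`, where `F` is the product of harmonic functions in the numerator.
Up to a constant the denominator is a product of at least two distinct factors `n + j`, so its
reciprocal is a rational combination of differences `1/(n+i) - 1/(n+i+1)` with `i < k + r`.
Summation by parts (`Slow.hasSum_telSum`) then reduces each series to values of `F` and to `J(ΔF)(x)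
= ∑ ΔF(n+x)/n` at `x = α - i`.

To evaluate `J(ΔF)`, note that `ΔH^{(s)}(y) = y^{-s}`, whence `ΔF(y) = (F₁(y) + S(y))/y` with `F₁`
simpler than `F`. Splitting `1/(n(n+x))` gives `mul_J_bdiff`: `x J(ΔF)(x) = D F₁(x) + F(x) - F(0) +
J S(x) - J S(0)`, where `D F₁(x) = ∑ (F₁(n+x) - F₁(n))/n`. The function `D F₁` solves `D(x) - D(x-1)
= J(ΔF₁)(x)`, whose right side is known from an earlier stage. A polynomial in harmonic functions
solves the same equation, and monotonicity of `D F₁` together with slow variation of the polynomial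
forces equality, in the manner of Bohr–Mollerup (`eq_of_monotoneOn_of_slow`).

The constants `J S(0)` are Euler sums and need no evaluation. For small `x ≠ 0` the formula for `J
S(x)` has a Laurent expansion at `0` with coefficients in the ring generated by zeta values, while
`J S` is continuous at `0`; so `J S(0)` is a coefficient of that expansion
(`HasLaurent.mem_of_tendsto`). The same argument settles integer `α`: the sum is continuous there,
so the poles of the closed form cancel and the sum is again a Laurent coefficient. -/

open Filter Topology Asymptotics

namespace ShiftedHarmonic

/-! ### Digamma and shifted harmonic numbers away from the poles -/

/-- The real number `y` is not one of `0, -1, -2, …`. -/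
def NonPole (y : ℝ) : Prop := ∀ j : ℕ, y ≠ -(j : ℝ)

lemma NonPole.of_pos {y : ℝ} (hy : 0 < y) : NonPole y := fun j h => by
  have : (0 : ℝ) ≤ j := j.cast_nonneg
  linarith

lemma NonPole.ne_zero {y : ℝ} (hy : NonPole y) : y ≠ 0 := by simpa using hy 0

lemma NonPole.add_nat {y : ℝ} (hy : NonPole y) (n : ℕ) : NonPole (y + n) := fun j h =>
  hy (j + n) (by push_cast; linarith)

lemma NonPole.add_one {y : ℝ} (hy : NonPole y) : NonPole (y + 1) := by
  simpa using hy.add_nat 1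

/-- The function `1/Γ` is continuous and vanishes at the poles, so the set where it is nonzero is
open and avoids them. -/
lemma NonPole.eventually {y : ℝ} (hy : NonPole y) : ∀ᶠ z in 𝓝 y, NonPole z := by
  have hc : ContinuousAt (fun z : ℝ => ((Complex.Gamma z)⁻¹)) y :=
    (Complex.differentiable_one_div_Gamma.continuous.comp Complex.continuous_ofReal).continuousAt
  have h0 : (Complex.Gamma y)⁻¹ ≠ 0 := by
    rw [Complex.Gamma_ofReal]
    exact inv_ne_zero (by exact_mod_cast Real.Gamma_ne_zero hy)
  filter_upwards [hc.eventually_ne h0] with z hz j hj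
  rw [Complex.Gamma_ofReal, hj, Real.Gamma_neg_nat_eq_zero] at hz
  simp at hz

lemma analyticAt_Gamma {y : ℝ} (hy : NonPole y) : AnalyticAt ℝ Real.Gamma y := by
  have h0 : (Complex.Gamma y)⁻¹ ≠ 0 := by
    rw [Complex.Gamma_ofReal]
    exact inv_ne_zero (by exact_mod_cast Real.Gamma_ne_zero hy)
  have h1 : AnalyticAt ℂ (fun s => (Complex.Gamma s)⁻¹) y :=
    Complex.differentiable_one_div_Gamma.analyticAt _
  have h2 := (h1.inv h0).re_ofReal
  refine h2.congr (Eventually.of_forall fun x => ?_)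
  simp [Complex.Gamma_ofReal]

lemma analyticAt_digamma {y : ℝ} (hy : NonPole y) : AnalyticAt ℝ digamma y :=
  (analyticAt_Gamma hy).deriv.div (analyticAt_Gamma hy) (Real.Gamma_ne_zero hy)

lemma analyticAt_iteratedDeriv_digamma (m : ℕ) {y : ℝ} (hy : NonPole y) :
    AnalyticAt ℝ (iteratedDeriv m digamma) y := by
  rw [iteratedDeriv_eq_iterate]
  exact (analyticAt_digamma hy).iterated_deriv m

lemma digamma_add_one {y : ℝ} (hy : NonPole y) : digamma (y + 1) = digamma y + y⁻¹ := by
  have hy0 := hy.ne_zero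
  have hd : DifferentiableAt ℝ Real.Gamma y := (analyticAt_Gamma hy).differentiableAt
  have h1 : logDeriv (fun z : ℝ => Real.Gamma (z + 1)) y = digamma (y + 1) := by
    simp only [digamma, logDeriv_apply, deriv_comp_add_const]
  have h2 : logDeriv (fun z : ℝ => Real.Gamma (z + 1)) y
      = logDeriv (fun z : ℝ => z * Real.Gamma z) y := by
    refine (logDeriv_congr_nhds ?_).self_of_nhds
    filter_upwards [hy.eventually] with z hz using Real.Gamma_add_one hz.ne_zero
  rw [← h1, h2, logDeriv_mul y hy0 (Real.Gamma_ne_zero hy) differentiableAt_fun_id hd, logDeriv_id']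
  simp [digamma, add_comm]

lemma iteratedDeriv_inv (m : ℕ) (y : ℝ) :
    iteratedDeriv m (fun z : ℝ => z⁻¹) y = (-1) ^ m * m.factorial * (y ^ (m + 1))⁻¹ := by
  rw [iteratedDeriv_eq_iterate]
  have := iter_deriv_inv (𝕜 := ℝ) m y
  rw [show (fun z : ℝ => z⁻¹) = Inv.inv from rfl, this,
    show (-1 - m : ℤ) = -((m + 1 : ℕ) : ℤ) by push_cast; ring, zpow_neg, zpow_natCast]

lemma iteratedDeriv_digamma_add_one (m : ℕ) {y : ℝ} (hy : NonPole y) :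
    iteratedDeriv m digamma (y + 1)
      = iteratedDeriv m digamma y + (-1) ^ m * m.factorial * (y ^ (m + 1))⁻¹ := by
  have h1 : iteratedDeriv m (fun z => digamma (z + 1)) y = iteratedDeriv m digamma (y + 1) :=
    congrFun (iteratedDeriv_comp_add_const m digamma 1) y
  have h2 : iteratedDeriv m (fun z => digamma (z + 1)) y
      = iteratedDeriv m (fun z => digamma z + z⁻¹) y := by
    refine Filter.EventuallyEq.iteratedDeriv_eq _ ?_
    filter_upwards [hy.eventually] with z hz using digamma_add_one hz
  rw [← h1, h2, iteratedDeriv_fun_add (analyticAt_digamma hy).contDiffAt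
    (contDiffAt_inv ℝ hy.ne_zero), iteratedDeriv_inv]

lemma neg_one_pow_div_mul (m : ℕ) (c : ℝ) :
    (-1 : ℝ) ^ m / m.factorial * ((-1) ^ m * m.factorial * c) = c := by
  have : (m.factorial : ℝ) ≠ 0 := by exact_mod_cast m.factorial_ne_zero
  field_simp
  rw [← pow_mul, mul_comm m 2, pow_mul]
  simp

lemma digamma_one : digamma 1 = -Real.eulerMascheroniConstant := by
  simp [digamma, logDeriv_apply, Real.hasDerivAt_Gamma_one.deriv]

lemma H_succ (m : ℕ) (a : ℝ) : H (m + 1) a = (-1) ^ m / (m.factorial : ℝ) *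
    (iteratedDeriv m digamma (a + 1) - iteratedDeriv m digamma 1) := by
  rcases m with _ | m
  · simp [H, digamma_one]
  · simp [H]

lemma H_succ_zero (m : ℕ) : H (m + 1) 0 = 0 := by simp [H_succ]

lemma H_zero {m : ℕ} (hm : 1 ≤ m) : H m 0 = 0 := by
  obtain ⟨m, rfl⟩ := Nat.exists_eq_add_of_le' hm
  exact H_succ_zero m

lemma H_sub_one {m : ℕ} (hm : 1 ≤ m) {y : ℝ} (hy : NonPole y) : H m (y - 1) = H m y - (y ^ m)⁻¹ := by
  obtain ⟨m, rfl⟩ := Nat.exists_eq_add_of_le' hm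
  rw [H_succ, H_succ, sub_add_cancel, iteratedDeriv_digamma_add_one m hy]
  have := neg_one_pow_div_mul m (y ^ (m + 1))⁻¹
  linear_combination -this

lemma H_add_one {m : ℕ} (hm : 1 ≤ m) {y : ℝ} (hy : NonPole (y + 1)) :
    H m (y + 1) = H m y + ((y + 1) ^ m)⁻¹ := by
  have := H_sub_one hm hy
  rw [add_sub_cancel_right] at this
  linarith

lemma H_add_nat {m : ℕ} (hm : 1 ≤ m) {y : ℝ} (hy : NonPole (y + 1)) (n : ℕ) :
    H m (y + n) = H m y + ∑ j ∈ Finset.range n, ((y + (j + 1)) ^ m)⁻¹ := by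
  induction n with
  | zero => simp
  | succ n ih =>
    have h : NonPole (y + n + 1) := by
      have := hy.add_nat n
      rwa [add_right_comm] at this
    rw [Finset.sum_range_succ, ← add_assoc (H m y), ← ih]
    push_cast
    rw [← add_assoc, H_add_one hm h]

lemma analyticAt_H {m : ℕ} (hm : 1 ≤ m) {y : ℝ} (hy : NonPole (y + 1)) : AnalyticAt ℝ (H m) y := by
  obtain ⟨m, rfl⟩ := Nat.exists_eq_add_of_le' hm
  have h1 : AnalyticAt ℝ (fun z => iteratedDeriv m digamma (z + 1)) y :=
    (analyticAt_iteratedDeriv_digamma m hy).comp_of_eq (f := fun z : ℝ => z + 1)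
      (analyticAt_id.add analyticAt_const) rfl
  exact ((h1.sub (analyticAt_const (v := iteratedDeriv m digamma 1))).const_smul
    (c := (-1) ^ m / (m.factorial : ℝ))).congr
    (Eventually.of_forall fun z => by simp [H_succ])

lemma H_succ_eq_deriv {m : ℕ} (hm : 1 ≤ m) (y : ℝ) :
    H (m + 1) y = -(deriv (H m) y - deriv (H m) 0) / m := by
  obtain ⟨m, rfl⟩ := Nat.exists_eq_add_of_le' hm
  have hd : ∀ z : ℝ, deriv (H (m + 1)) z
      = (-1) ^ m / (m.factorial : ℝ) * iteratedDeriv (m + 1) digamma (z + 1) := fun z => by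
    rw [funext (H_succ m), deriv_const_mul_field, deriv_sub_const,
      deriv_comp_add_const (f := iteratedDeriv m digamma), iteratedDeriv_succ]
  have h1 : (m.factorial : ℝ) ≠ 0 := by exact_mod_cast m.factorial_ne_zero
  rw [hd, hd, H_succ, Nat.factorial_succ]
  push_cast
  have h2 : (m : ℝ) + 1 ≠ 0 := by positivity
  field_simp
  rw [zero_add]
  ring

/-! ### Monotonicity, series and derivatives of `H` -/

lemma digamma_monotoneOn : MonotoneOn digamma (Set.Ioi 0) := by
  have h := Real.convexOn_log_Gamma.monotoneOn_deriv (fun x (hx : 0 < x) =>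
    DifferentiableAt.log (analyticAt_Gamma (.of_pos hx)).differentiableAt (Real.Gamma_pos_of_pos hx).ne')
  refine h.congr fun x (hx : 0 < x) => ?_
  exact deriv.log (analyticAt_Gamma (.of_pos hx)).differentiableAt (Real.Gamma_pos_of_pos hx).ne'

lemma H_one_monotoneOn : MonotoneOn (H 1) (Set.Ioi (-1)) := fun x hx y hy h => by
  have := digamma_monotoneOn (a := x + 1) (b := y + 1)
    (by simp at *; linarith) (by simp at *; linarith) (by linarith)
  simpa [H] using this

/-- For a natural number `k ≥ |x|`, both `f(y+x)` and `f(y)` lie between `f(y-k)` and `f(y+k)`,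
which are `2k` unit steps apart. -/
lemma exists_abs_sub_le_div {f : ℝ → ℝ} (hf : MonotoneOn f (Set.Ici 0))
    (hrec : ∀ y : ℝ, 0 ≤ y → f (y + 1) ≤ f y + (y + 1)⁻¹) (x : ℝ) :
    ∃ C : ℝ, ∀ᶠ y : ℝ in atTop, |f (y + x) - f y| ≤ C / y := by
  obtain ⟨k, hk⟩ := exists_nat_ge (|x|)
  have hk' := abs_le.1 hk
  have hrec' : ∀ (n : ℕ) (y : ℝ), 0 < y → f (y + n) ≤ f y + n * y⁻¹ := by
    intro n y hy
    induction n with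
    | zero => simp
    | succ n ih =>
      have h1 := hrec (y + n) (by positivity)
      have h2 : (y + n + 1)⁻¹ ≤ y⁻¹ := inv_anti₀ hy (by linarith [n.cast_nonneg (α := ℝ)])
      push_cast
      rw [← add_assoc]
      linarith
  -- For `y ≥ 2k + 1` one has `y - k ≥ y/2`, so the `2k` steps add up to at most `2k · 2/y`.
  refine ⟨4 * k, ?_⟩
  filter_upwards [eventually_ge_atTop (2 * k + 1 : ℝ)] with y hy
  have hk0 : (0 : ℝ) ≤ k := k.cast_nonneg
  have h1 := hrec' (2 * k) (y - k) (by linarith)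
  have e : y - k + (2 * k : ℕ) = y + k := by push_cast; ring
  rw [e] at h1
  have h2 : f (y - k) ≤ f (y + x) := hf (by simp; linarith) (by simp; linarith) (by linarith)
  have h3 : f (y - k) ≤ f y := hf (by simp; linarith) (by simp; linarith) (by linarith)
  have h4 : f (y + x) ≤ f (y + k) := hf (by simp; linarith) (by simp; linarith) (by linarith)
  have h5 : f y ≤ f (y + k) := hf (by simp; linarith) (by simp; linarith) (by linarith)
  have h6 : ((2 * k : ℕ) : ℝ) * (y - k)⁻¹ ≤ 4 * k / y := by
    push_cast
    rw [← div_eq_mul_inv, div_le_div_iff₀ (by linarith) (by linarith)]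
    nlinarith
  rw [abs_le]
  constructor <;> linarith

lemma H_add_one_le {m : ℕ} (hm : 1 ≤ m) {y : ℝ} (hy : 0 ≤ y) : H m (y + 1) ≤ H m y + (y + 1)⁻¹ := by
  rw [H_add_one hm (.of_pos (by linarith))]
  gcongr
  exact le_self_pow₀ (by linarith) (by omega)

/-- The `j`-th term of the series `∑ (1 / (j+1)^s - 1 / (y+j+1)^s)` for `H s y`. -/
noncomputable def HTerm (s : ℕ) (j : ℕ) (y : ℝ) : ℝ :=
  (((j : ℝ) + 1) ^ s)⁻¹ - ((y + (j + 1)) ^ s)⁻¹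

lemma inv_add_le {c y : ℝ} (hc : 0 < c) (hc1 : c ≤ 1) (hy : c ≤ y + 1) (j : ℕ) :
    (y + (j + 1))⁻¹ ≤ c⁻¹ * ((j : ℝ) + 1)⁻¹ := by
  rw [← mul_inv]
  apply inv_anti₀ (by positivity)
  nlinarith [j.cast_nonneg (α := ℝ)]

lemma inv_add_pow_le {c y : ℝ} (hc : 0 < c) (hc1 : c ≤ 1) (hy : c ≤ y + 1) (s j : ℕ) :
    ((y + (j + 1)) ^ s)⁻¹ ≤ (c ^ s)⁻¹ * (((j : ℝ) + 1) ^ s)⁻¹ := by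
  rw [← inv_pow, ← inv_pow, ← inv_pow, ← mul_pow]
  have : 0 < y + (j + 1) := by linarith [j.cast_nonneg (α := ℝ)]
  exact pow_le_pow_left₀ (by positivity) (inv_add_le hc hc1 hy j) s

lemma summable_inv_succ_pow {s : ℕ} (hs : 2 ≤ s) : Summable (fun j : ℕ => (((j : ℝ) + 1) ^ s)⁻¹) := by
  have := (summable_nat_add_iff 1).2 (Real.summable_nat_pow_inv (p := s).2 (by omega))
  simpa using this

lemma exists_lower {y : ℝ} (hy : -1 < y) : ∃ c : ℝ, 0 < c ∧ c ≤ 1 ∧ c < y + 1 :=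
  ⟨min 1 ((y + 1) / 2), lt_min one_pos (by linarith), min_le_left _ _,
    (min_le_right _ _).trans_lt (by linarith)⟩

lemma summable_inv_add_pow {s : ℕ} (hs : 2 ≤ s) {y : ℝ} (hy : -1 < y) :
    Summable (fun j : ℕ => ((y + (j + 1)) ^ s)⁻¹) := by
  obtain ⟨c, hc, hc1, hcy⟩ := exists_lower hy
  refine Summable.of_nonneg_of_le (fun j => ?_) (fun j => inv_add_pow_le hc hc1 hcy.le s j)
    ((summable_inv_succ_pow hs).mul_left _)
  have : 0 < y + (j + 1) := by linarith [j.cast_nonneg (α := ℝ)]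
  positivity

lemma summable_HTerm {s : ℕ} (hs : 1 ≤ s) {y : ℝ} (hy : -1 < y) :
    Summable (fun j : ℕ => HTerm s j y) := by
  rcases hs.eq_or_lt with rfl | hs
  · obtain ⟨c, hc, hc1, hcy⟩ := exists_lower hy
    refine Summable.of_norm_bounded (g := fun j : ℕ => |y| * c⁻¹ * (((j : ℝ) + 1) ^ 2)⁻¹)
      ((summable_inv_succ_pow le_rfl).mul_left _) fun j => ?_
    have h1 : 0 < y + (j + 1) := by linarith [j.cast_nonneg (α := ℝ)]
    have h2 : HTerm 1 j y = y * ((j : ℝ) + 1)⁻¹ * (y + (j + 1))⁻¹ := by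
      simp only [HTerm, pow_one]
      field_simp
      ring
    rw [h2, Real.norm_eq_abs, abs_mul, abs_mul, abs_of_pos (inv_pos.2 h1),
      abs_of_pos (a := ((j : ℝ) + 1)⁻¹) (by positivity)]
    calc |y| * ((j : ℝ) + 1)⁻¹ * (y + (j + 1))⁻¹
        ≤ |y| * ((j : ℝ) + 1)⁻¹ * (c⁻¹ * ((j : ℝ) + 1)⁻¹) := by
          gcongr
          exact inv_add_le hc hc1 hcy.le j
      _ = _ := by rw [sq, mul_inv]; ring
  · exact (summable_inv_succ_pow hs).sub (summable_inv_add_pow hs hy)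

lemma hasDerivAt_tsum_HTerm {s : ℕ} (hs : 1 ≤ s) {y : ℝ} (hy : -1 < y) :
    HasDerivAt (fun z => ∑' j : ℕ, HTerm s j z) (s * ∑' j : ℕ, ((y + (j + 1)) ^ (s + 1))⁻¹) y := by
  obtain ⟨c, hc, hc1, hcy⟩ := exists_lower hy
  rw [← tsum_mul_left]
  refine hasDerivAt_tsum_of_isPreconnected (t := Set.Ioi (c - 1)) (y₀ := y)
    (u := fun j : ℕ => (s : ℝ) * ((c ^ (s + 1))⁻¹ * (((j : ℝ) + 1) ^ (s + 1))⁻¹))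
    (g := fun (j : ℕ) (z : ℝ) => HTerm s j z)
    (g' := fun (j : ℕ) (z : ℝ) => (s : ℝ) * ((z + (j + 1)) ^ (s + 1))⁻¹)
    (((summable_inv_succ_pow (by omega)).mul_left _).mul_left _) isOpen_Ioi isPreconnected_Ioi
    (fun j z hz => ?_) (fun j z hz => ?_) (by simp; linarith) (summable_HTerm hs hy)
    (by simp; linarith)
  · have hz : c - 1 < z := hz
    have h1 : 0 < z + (j + 1) := by linarith [j.cast_nonneg (α := ℝ)]
    have h2 : HasDerivAt (fun z : ℝ => (z + (j + 1)) ^ s) (s * (z + (j + 1)) ^ (s - 1) * 1) z :=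
      ((hasDerivAt_id z).add_const _).pow s
    have h3 := (h2.inv (by positivity)).const_sub ((((j : ℝ) + 1) ^ s)⁻¹)
    convert! h3 using 1
    obtain ⟨s, rfl⟩ := Nat.exists_eq_add_of_le' hs
    simp only [Nat.add_sub_cancel]
    field_simp
    ring
  · have hz : c - 1 < z := hz
    have h1 : 0 < z + (j + 1) := by linarith [j.cast_nonneg (α := ℝ)]
    rw [Real.norm_eq_abs, abs_of_nonneg (by positivity)]
    gcongr
    exact inv_add_pow_le hc hc1 (by linarith) _ _

lemma H_nat {m : ℕ} (hm : 1 ≤ m) (n : ℕ) : H m n = ∑ j ∈ Finset.range n, (((j : ℝ) + 1) ^ m)⁻¹ := by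
  have := H_add_nat hm (y := 0) (.of_pos (by simp)) n
  simpa [H_zero hm] using this

lemma sum_HTerm {s : ℕ} (hs : 1 ≤ s) {y : ℝ} (hy : NonPole (y + 1)) (n : ℕ) :
    ∑ j ∈ Finset.range n, HTerm s j y = H s y - (H s (y + n) - H s n) := by
  rw [H_add_nat hs hy, H_nat hs]
  simp only [HTerm, Finset.sum_sub_distrib]
  ring

/-- The `n`-th partial sum differs from `H 1 y` by `H 1 (y+n) - H 1 n`, which is `O(1/n)` by
monotonicity; this monotonicity comes from the log-convexity of `Γ`. -/
lemma H_one_eq_tsum {y : ℝ} (hy : -1 < y) : H 1 y = ∑' j : ℕ, HTerm 1 j y := by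
  obtain ⟨C, hC⟩ := exists_abs_sub_le_div (H_one_monotoneOn.mono fun z (hz : 0 ≤ z) => by
    simp; linarith) (fun z hz => H_add_one_le le_rfl hz) y
  have h1 : Tendsto (fun n : ℕ => H 1 (y + n) - H 1 n) atTop (𝓝 0) := by
    have h2 : Tendsto (fun n : ℕ => C / (n : ℝ)) atTop (𝓝 0) :=
      tendsto_const_nhds.div_atTop tendsto_natCast_atTop_atTop
    refine squeeze_zero_norm' ?_ h2
    filter_upwards [tendsto_natCast_atTop_atTop.eventually hC] with n hn
    rwa [add_comm y, Real.norm_eq_abs]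
  have h2 := (summable_HTerm le_rfl hy).hasSum.tendsto_sum_nat
  simp_rw [sum_HTerm le_rfl (NonPole.of_pos (show 0 < y + 1 by linarith))] at h2
  have h3 := h1.const_sub (H 1 y)
  rw [sub_zero] at h3
  exact tendsto_nhds_unique h3 h2

/-- Termwise differentiation passes from order `s` to order `s + 1`. -/
lemma H_eq_tsum {s : ℕ} (hs : 1 ≤ s) {y : ℝ} (hy : -1 < y) : H s y = ∑' j : ℕ, HTerm s j y := by
  induction s, hs using Nat.le_induction generalizing y with
  | base => exact H_one_eq_tsum hy
  | succ s hs ih =>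
    have hd : ∀ z : ℝ, -1 < z → deriv (H s) z = s * ∑' j : ℕ, ((z + (j + 1)) ^ (s + 1))⁻¹ := by
      intro z hz
      refine ((hasDerivAt_tsum_HTerm hs hz).congr_of_eventuallyEq ?_).deriv
      filter_upwards [lt_mem_nhds hz] with w hw using ih hw
    have h0 : (s : ℝ) ≠ 0 := by positivity
    rw [H_succ_eq_deriv hs, hd y hy, hd 0 (by norm_num)]
    unfold HTerm
    rw [Summable.tsum_sub (summable_inv_succ_pow (by omega)) (summable_inv_add_pow (by omega) hy)]
    field_simp
    simp

lemma hasSum_zetaValue {s : ℕ} (hs : 2 ≤ s) :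
    HasSum (fun j : ℕ => (((j : ℝ) + 1) ^ s)⁻¹) (zetaValue s) := by
  have h1 : riemannZeta s = ((∑' j : ℕ, (((j : ℝ) + 1) ^ s)⁻¹ : ℝ) : ℂ) := by
    rw [zeta_nat_eq_tsum_of_gt_one (by omega), Summable.tsum_eq_zero_add]
    · push_cast
      simp [show s ≠ 0 by omega]
    · have := Complex.hasSum_ofReal.2 (Real.summable_nat_pow_inv (p := s).2 (by omega)).hasSum
      simpa using this.summable
  rw [zetaValue, h1, Complex.ofReal_re]
  exact (summable_inv_succ_pow hs).hasSum

/-- This differential relation is what places all Taylor coefficients of `H s` at `0` in the ring of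
zeta values. -/
lemma hasDerivAt_H {s : ℕ} (hs : 1 ≤ s) {y : ℝ} (hy : -1 < y) :
    HasDerivAt (H s) (s * (zetaValue (s + 1) - H (s + 1) y)) y := by
  have h1 : zetaValue (s + 1) - H (s + 1) y = ∑' j : ℕ, ((y + (j + 1)) ^ (s + 1))⁻¹ := by
    rw [H_eq_tsum (by omega) hy, ← (hasSum_zetaValue (s := s + 1) (by omega)).tsum_eq]
    unfold HTerm
    rw [Summable.tsum_sub (summable_inv_succ_pow (by omega)) (summable_inv_add_pow (by omega) hy)]
    ring
  rw [h1]
  refine (hasDerivAt_tsum_HTerm hs hy).congr_of_eventuallyEq ?_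
  filter_upwards [lt_mem_nhds hy] with w hw using H_eq_tsum hs hw

lemma H_monotoneOn {s : ℕ} (hs : 1 ≤ s) : MonotoneOn (H s) (Set.Ici 0) := fun x hx y hy h => by
  have hx : 0 ≤ x := hx
  have hy : 0 ≤ y := hy
  rw [H_eq_tsum hs (by linarith), H_eq_tsum hs (by linarith)]
  refine Summable.tsum_le_tsum (fun j => ?_) (summable_HTerm hs (by linarith))
    (summable_HTerm hs (by linarith))
  unfold HTerm
  gcongr

lemma H_nonneg {s : ℕ} (hs : 1 ≤ s) {y : ℝ} (hy : 0 ≤ y) : 0 ≤ H s y := by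
  have := H_monotoneOn hs (a := 0) (b := y) (by simp) hy hy
  rwa [H_zero hs] at this

/-! ### Slowly varying functions -/

lemma isBigO_rpow_of_le {p q : ℝ} (h : p ≤ q) :
    (fun y : ℝ => y ^ p) =O[atTop] (fun y : ℝ => y ^ q) := by
  refine IsBigO.of_bound 1 ?_
  filter_upwards [eventually_ge_atTop 1] with y hy
  rw [Real.norm_of_nonneg (by positivity), Real.norm_of_nonneg (by positivity), one_mul]
  exact Real.rpow_le_rpow_of_exponent_le hy h

lemma isBigO_rpow_mul {f g : ℝ → ℝ} {p q r : ℝ} (hf : f =O[atTop] fun y => y ^ p)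
    (hg : g =O[atTop] fun y => y ^ q) (h : p + q = r) :
    (fun y => f y * g y) =O[atTop] fun y => y ^ r := by
  refine (hf.mul hg).congr' (EventuallyEq.refl _ _) ?_
  filter_upwards [eventually_gt_atTop 0] with y hy
  rw [← h, Real.rpow_add hy]

lemma isBigO_rpow_comp_add {f : ℝ → ℝ} {p : ℝ} (hf : f =O[atTop] fun y => y ^ p) (x : ℝ) :
    (fun y => f (y + x)) =O[atTop] fun y => y ^ p := by
  refine (hf.comp_tendsto (tendsto_atTop_add_const_right _ x tendsto_id)).trans ?_
  have h1 : Tendsto (fun y : ℝ => ((y + x) / y) ^ p) atTop (𝓝 1) := by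
    have h2 : Tendsto (fun y : ℝ => (y + x) / y) atTop (𝓝 1) := by
      have h3 : Tendsto (fun y : ℝ => 1 + x / y) atTop (𝓝 (1 + 0)) :=
        (tendsto_const_nhds.div_atTop tendsto_id).const_add 1
      rw [add_zero] at h3
      refine h3.congr' ?_
      filter_upwards [eventually_gt_atTop 0] with y hy
      field_simp
    simpa using h2.rpow_const (p := p) (Or.inl one_ne_zero)
  have h2 := (h1.isBigO_one ℝ).mul (isBigO_refl (fun y : ℝ => y ^ p) atTop)
  refine h2.congr' ?_ (by simp)
  filter_upwards [eventually_gt_atTop 0, eventually_gt_atTop (-x)] with y hy hyx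
  rw [← Real.mul_rpow (div_nonneg (by linarith) hy.le) hy.le, div_mul_cancel₀ _ hy.ne']
  rfl

/-- Functions growing more slowly than every positive power, with increments smaller than
`y ^ (ε - 1)`, as `y → ∞`. -/
def Slow (f : ℝ → ℝ) : Prop :=
  (∀ ε : ℝ, 0 < ε → f =O[atTop] fun y => y ^ ε) ∧
    ∀ x ε : ℝ, 0 < ε → (fun y => f (y + x) - f y) =O[atTop] fun y => y ^ (ε - 1)

lemma Slow.const (c : ℝ) : Slow fun _ => c := by
  refine ⟨fun ε hε => ?_, fun x ε _ => by simpa using isBigO_zero _ _⟩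
  have := isBigO_rpow_of_le hε.le
  simp only [Real.rpow_zero] at this
  exact (isBigO_const_const c (one_ne_zero (α := ℝ)) _).trans this

lemma Slow.add {f g : ℝ → ℝ} (hf : Slow f) (hg : Slow g) : Slow fun y => f y + g y :=
  ⟨fun ε hε => (hf.1 ε hε).add (hg.1 ε hε), fun x ε hε =>
    ((hf.2 x ε hε).add (hg.2 x ε hε)).congr_left fun y => by ring⟩

lemma Slow.comp_add {f : ℝ → ℝ} (hf : Slow f) (x : ℝ) : Slow fun y => f (y + x) :=
  ⟨fun ε hε => isBigO_rpow_comp_add (hf.1 ε hε) x, fun z ε hε =>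
    ((hf.2 (z + x) ε hε).sub (hf.2 x ε hε)).congr_left fun y => by
      simp only [add_assoc]; ring⟩

/-- The increment of a product is `(Δf) g(y+x) + f (Δg)`; allotting `ε/2` to each factor keeps the
exponent `ε - 1`. -/
lemma Slow.mul {f g : ℝ → ℝ} (hf : Slow f) (hg : Slow g) : Slow fun y => f y * g y := by
  refine ⟨fun ε hε => isBigO_rpow_mul (hf.1 (ε / 2) (by linarith)) (hg.1 (ε / 2) (by linarith))
    (by ring), fun x ε hε => ?_⟩
  have h1 := isBigO_rpow_mul (r := ε - 1) (hf.2 x (ε / 2) (by linarith))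
    ((hg.comp_add x).1 (ε / 2) (by linarith)) (by ring)
  have h2 := isBigO_rpow_mul (r := ε - 1) (hf.1 (ε / 2) (by linarith))
    (hg.2 x (ε / 2) (by linarith)) (by ring)
  exact (h1.add h2).congr_left fun y => by ring

lemma Slow.const_mul {f : ℝ → ℝ} (hf : Slow f) (c : ℝ) : Slow fun y => c * f y :=
  (Slow.const c).mul hf

lemma Slow.sub {f g : ℝ → ℝ} (hf : Slow f) (hg : Slow g) : Slow fun y => f y - g y := by
  simpa [sub_eq_add_neg] using hf.add (hg.const_mul (-1))

lemma Slow.pow {f : ℝ → ℝ} (hf : Slow f) (n : ℕ) : Slow fun y => f y ^ n := by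
  induction n with
  | zero => simpa using Slow.const 1
  | succ n ih => simpa [pow_succ] using ih.mul hf

lemma Slow.tendsto_sub {f : ℝ → ℝ} (hf : Slow f) (x : ℝ) :
    Tendsto (fun y => f (y + x) - f y) atTop (𝓝 0) := by
  refine (hf.2 x (1 / 2) (by norm_num)).trans_tendsto ?_
  have := tendsto_rpow_neg_atTop (y := 1 / 2) (by norm_num)
  norm_num at this ⊢
  exact this

lemma H_le_two_add_log {m : ℕ} (hm : 1 ≤ m) {y : ℝ} (hy : 1 ≤ y) : H m y ≤ 2 + Real.log y := by
  have h1 : H m y ≤ H m ⌈y⌉₊ := H_monotoneOn hm (by simp; linarith) (by simp) (Nat.le_ceil y)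
  have h2 : H m ⌈y⌉₊ ≤ harmonic ⌈y⌉₊ := by
    rw [H_nat hm, harmonic]
    push_cast
    gcongr with j _
    exact le_self_pow₀ (by simp) (by omega)
  have h3 := harmonic_le_one_add_log ⌈y⌉₊
  have h4 : Real.log ⌈y⌉₊ ≤ Real.log (2 * y) :=
    Real.log_le_log (by exact_mod_cast Nat.ceil_pos.2 (by linarith))
      (by linarith [Nat.ceil_lt_add_one (show 0 ≤ y by linarith)])
  rw [Real.log_mul (by norm_num) (by linarith)] at h4
  have := Real.log_two_lt_d9
  linarith

lemma Slow.H {m : ℕ} (hm : 1 ≤ m) : Slow (H m) := by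
  refine ⟨fun ε hε => ?_, fun x ε hε => ?_⟩
  · have h1 : (fun y : ℝ => 2 + Real.log y) =O[atTop] fun y => y ^ ε :=
      ((Slow.const 2).1 ε hε).add (isLittleO_log_rpow_atTop hε).isBigO
    refine (IsBigO.of_bound 1 ?_).trans h1
    filter_upwards [eventually_ge_atTop 1] with y hy
    have h2 := H_le_two_add_log hm hy
    have h3 := H_nonneg hm (show 0 ≤ y by linarith)
    rw [Real.norm_of_nonneg h3, Real.norm_of_nonneg (h3.trans h2), one_mul]
    exact h2
  · obtain ⟨C, hC⟩ := exists_abs_sub_le_div (H_monotoneOn hm) (fun y hy => H_add_one_le hm hy) x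
    have h1 : (fun y => ShiftedHarmonic.H m (y + x) - ShiftedHarmonic.H m y)
        =O[atTop] fun y : ℝ => y ^ (-1 : ℝ) := by
      refine IsBigO.of_bound C ?_
      filter_upwards [hC, eventually_gt_atTop 0] with y hy hy0
      rw [Real.rpow_neg_one, Real.norm_eq_abs, Real.norm_of_nonneg (by positivity)]
      exact hy
    exact h1.trans (isBigO_rpow_of_le (by linarith))

lemma summable_comp_natCast_add {g : ℝ → ℝ} (hg : g =O[atTop] fun y => y ^ (-(3 / 2) : ℝ)) (x : ℝ) :
    Summable fun n : ℕ => g (n + 1 + x) := by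
  have h := (isBigO_rpow_comp_add hg (1 + x)).comp_tendsto tendsto_natCast_atTop_atTop
  refine (summable_of_isBigO_nat (Real.summable_nat_rpow.2 (by norm_num)) h).congr fun n => ?_
  simp [add_assoc]

/-! ### The sums `J` and `D` and their difference equations -/

/-- The sum `∑_{n ≥ 1} g(n + x) / n`. -/
noncomputable def J (g : ℝ → ℝ) (x : ℝ) : ℝ := ∑' n : ℕ, g (n + 1 + x) / (n + 1)

/-- Decay that makes `J g x` absolutely convergent. -/
def Decays (g : ℝ → ℝ) : Prop := g =O[atTop] fun y => y ^ (-(1 / 2) : ℝ)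

lemma isBigO_inv_rpow : (fun y : ℝ => y⁻¹) =O[atTop] fun y => y ^ (-1 : ℝ) :=
  (isBigO_refl _ _).congr_left fun y => Real.rpow_neg_one y

lemma Decays.summable_J {g : ℝ → ℝ} (hg : Decays g) (x : ℝ) :
    Summable fun n : ℕ => g (n + 1 + x) / (n + 1) := by
  have h1 := isBigO_rpow_mul (r := -(3 / 2)) (isBigO_rpow_comp_add hg x) isBigO_inv_rpow (by norm_num)
  refine (summable_comp_natCast_add h1 0).congr fun n => ?_
  simp [div_eq_mul_inv]

lemma Decays.hasSum_J {g : ℝ → ℝ} (hg : Decays g) (x : ℝ) :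
    HasSum (fun n : ℕ => g (n + 1 + x) / (n + 1)) (J g x) := (hg.summable_J x).hasSum

lemma Decays.add {f g : ℝ → ℝ} (hf : Decays f) (hg : Decays g) : Decays fun y => f y + g y :=
  IsBigO.add hf hg

lemma Decays.const_mul {f : ℝ → ℝ} (hf : Decays f) (c : ℝ) : Decays fun y => c * f y :=
  IsBigO.const_mul_left hf c

lemma Decays.mul_inv_pow {f : ℝ → ℝ} (hf : Slow f) {m : ℕ} (hm : 1 ≤ m) :
    Decays fun y => f y * (y ^ m)⁻¹ := by
  refine isBigO_rpow_mul (p := 1 / 2) (q := -1) (hf.1 _ (by norm_num)) ?_ (by norm_num)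
  refine ((isBigO_refl (fun y : ℝ => y ^ (-m : ℝ)) atTop).congr' ?_ (EventuallyEq.refl _ _)).trans
    (isBigO_rpow_of_le (by simpa using hm))
  filter_upwards [eventually_gt_atTop 0] with y hy
  rw [Real.rpow_neg hy.le, Real.rpow_natCast]

lemma J_add {f g : ℝ → ℝ} (hf : Decays f) (hg : Decays g) (x : ℝ) :
    J (fun y => f y + g y) x = J f x + J g x := by
  rw [J, J, J, ← (hf.summable_J x).tsum_add (hg.summable_J x)]
  simp only [add_div]

lemma J_const_mul (f : ℝ → ℝ) (c x : ℝ) : J (fun y => c * f y) x = c * J f x := by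
  simp only [J, ← tsum_mul_left, mul_div_assoc]

lemma J_congr {f g : ℝ → ℝ} {x : ℝ} (hx : NonPole (x + 1)) (h : ∀ y, NonPole y → f y = g y) :
    J f x = J g x := by
  refine tsum_congr fun n => ?_
  rw [h]
  rw [show (n : ℝ) + 1 + x = x + 1 + n by ring]
  exact hx.add_nat n

/-- The backward difference. -/
def bdiff (F : ℝ → ℝ) (y : ℝ) : ℝ := F y - F (y - 1)

lemma Slow.decays_bdiff {F : ℝ → ℝ} (hF : Slow F) : Decays (bdiff F) := by
  have := (hF.2 (-1) (1 / 2) (by norm_num)).neg_left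
  norm_num at this
  exact this.congr_left fun y => by rw [bdiff, ← sub_eq_add_neg]

/-- The sum `∑_{n ≥ 1} (F(n + x) - F(n)) / n`. -/
noncomputable def D (F : ℝ → ℝ) (x : ℝ) : ℝ := ∑' n : ℕ, (F (n + 1 + x) - F (n + 1)) / (n + 1)

lemma Slow.decays_sub {F : ℝ → ℝ} (hF : Slow F) (x : ℝ) : Decays (fun y => F (y + x) - F y) := by
  have := hF.2 x (1 / 2) (by norm_num)
  norm_num at this
  exact this

lemma Slow.hasSum_D {F : ℝ → ℝ} (hF : Slow F) (x : ℝ) :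
    HasSum (fun n : ℕ => (F (n + 1 + x) - F (n + 1)) / (n + 1)) (D F x) := by
  have := (hF.decays_sub x).summable_J 0
  simp only [add_zero] at this
  exact this.hasSum

lemma D_zero (F : ℝ → ℝ) : D F 0 = 0 := by simp [D]

lemma Slow.D_sub {F : ℝ → ℝ} (hF : Slow F) (x : ℝ) : D F x - D F (x - 1) = J (bdiff F) x := by
  rw [← ((hF.hasSum_D x).sub (hF.hasSum_D (x - 1))).tsum_eq, J]
  refine tsum_congr fun n => ?_
  rw [bdiff, ← add_sub_assoc]
  ring

lemma Slow.D_monotoneOn {F : ℝ → ℝ} (hF : Slow F) (hm : MonotoneOn F (Set.Ici 0)) :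
    MonotoneOn (D F) (Set.Ici 0) := fun x (hx : 0 ≤ x) y (hy : 0 ≤ y) h => by
  refine hasSum_le (fun n => ?_) (hF.hasSum_D x) (hF.hasSum_D y)
  have : F (n + 1 + x) ≤ F (n + 1 + y) :=
    hm (by simp; positivity) (by simp; positivity) (by linarith)
  gcongr

/-- The difference `A - C` is unchanged by unit steps and vanishes at the naturals. Monotonicity
puts `A(n+x)` between `A(n-k) = C(n-k)` and `A(n+k) = C(n+k)`, and slow variation of `C` brings both
bounds to within `o(1)` of `C(n+x)`. Hence `A(x) - C(x) = A(n+x) - C(n+x)` tends to `0`. -/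
lemma eq_of_monotoneOn_of_slow {A C : ℝ → ℝ} (hA : MonotoneOn A (Set.Ici 0)) (hC : Slow C)
    (hrec : ∀ x, NonPole x → A x - A (x - 1) = C x - C (x - 1)) (h0 : A 0 = C 0) {x : ℝ}
    (hx : NonPole (x + 1)) : A x = C x := by
  have hper : ∀ z, NonPole (z + 1) → ∀ n : ℕ, A (z + n) - C (z + n) = A z - C z := by
    intro z hz n
    induction n with
    | zero => simp
    | succ n ih =>
      have h := hrec (z + n + 1) (by rw [add_right_comm]; exact hz.add_nat n)
      rw [add_sub_cancel_right] at h
      push_cast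
      rw [← add_assoc]
      linarith
  have hnat : ∀ n : ℕ, A n = C n := fun n => by
    have := hper 0 (.of_pos (by norm_num)) n
    rw [zero_add] at this
    linarith
  obtain ⟨k, hk⟩ := exists_nat_ge (|x|)
  have hk' := abs_le.1 hk
  have hlim := fun z : ℝ => (hC.tendsto_sub z).comp (tendsto_natCast_atTop_atTop (R := ℝ))
  have hlow := (hlim (-k)).sub (hlim x)
  have hup := (hlim k).sub (hlim x)
  rw [sub_zero] at hlow hup
  have hc : Tendsto (fun _ : ℕ => A x - C x) atTop (𝓝 0) := by
    refine tendsto_of_tendsto_of_tendsto_of_le_of_le' hlow hup ?_ ?_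
    · filter_upwards [eventually_ge_atTop k] with n hn
      have hn' : (k : ℝ) ≤ n := by exact_mod_cast hn
      have h1 : A ((n - k : ℕ) : ℝ) ≤ A (n + x) :=
        hA (by simp) (by simp; linarith) (by rw [Nat.cast_sub hn]; linarith)
      rw [hnat, Nat.cast_sub hn] at h1
      have h2 := hper x hx n
      rw [add_comm x] at h2
      simp only [Function.comp, ← sub_eq_add_neg]
      linarith
    · filter_upwards [eventually_ge_atTop k] with n hn
      have hn' : (k : ℝ) ≤ n := by exact_mod_cast hn
      have h1 : A (n + x) ≤ A ((n + k : ℕ) : ℝ) :=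
        hA (by simp; linarith) (by simp; positivity) (by push_cast; linarith)
      rw [hnat] at h1
      push_cast at h1
      have h2 := hper x hx n
      rw [add_comm x] at h2
      simp only [Function.comp]
      linarith
  have := tendsto_nhds_unique tendsto_const_nhds hc
  linarith

lemma hasSum_of_summable_of_telescoping {a G : ℕ → ℝ} (ha : Summable a)
    (h : ∀ n, a n = G (n + 1) - G n) {l : ℝ} (hl : Tendsto G atTop (𝓝 l)) : HasSum a (l - G 0) := by
  rw [ha.hasSum_iff_tendsto_nat]
  simp_rw [h, Finset.sum_range_sub]
  exact hl.sub_const _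

/-- The reduction coming from `1/(n(n+x)) = (1/n - 1/(n+x))/x`. -/
lemma mul_J_bdiff {F F₁ S : ℝ → ℝ} (hF : Slow F) (hF₁ : Slow F₁) (hS : Decays S)
    (hd : ∀ y, NonPole y → bdiff F y = (F₁ y + S y) / y) {x : ℝ} (hx : NonPole (x + 1)) :
    x * J (bdiff F) x = D F₁ x + (F x - F 0) + (J S x - J S 0) := by
  have hS0 := hS.hasSum_J 0
  simp only [add_zero] at hS0
  have h1 := ((((hF.decays_bdiff.hasSum_J x).mul_left x).sub (hF₁.hasSum_D x)).sub
    (hS.hasSum_J x)).add hS0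
  -- Splitting `x/(n(n+x))` cancels every `F₁` and `S` term at `n + x`; what remains is `ΔF(n) -
  -- ΔF(n+x)`, the increment of `F(n) - F(n+x)`.
  have h2 : ∀ n : ℕ, x * (bdiff F (n + 1 + x) / (n + 1)) -
      (F₁ (n + 1 + x) - F₁ (n + 1)) / (n + 1) - S (n + 1 + x) / (n + 1) + S (n + 1) / (n + 1)
      = (F ((n + 1 : ℕ) : ℝ) - F ((n + 1 : ℕ) + x)) - (F n - F (n + x)) := by
    intro n
    have hn : NonPole ((n : ℝ) + 1) := .of_pos (by positivity)
    have hy : NonPole ((n : ℝ) + 1 + x) := by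
      rw [show (n : ℝ) + 1 + x = x + 1 + n by ring]
      exact hx.add_nat n
    have e3 : bdiff F (n + 1) = F (n + 1) - F n := by simp [bdiff]
    have e4 : bdiff F (n + 1 + x) = F (n + 1 + x) - F (n + x) := by
      rw [bdiff]
      ring_nf
    push_cast
    have e5 : F (↑n + 1) - F (↑n + 1 + x) - (F ↑n - F (↑n + x))
        = bdiff F (n + 1) - bdiff F (n + 1 + x) := by rw [e3, e4]; ring
    rw [e5, hd _ hn, hd _ hy]
    have := hn.ne_zero
    have := hy.ne_zero
    field_simp
    ring
  simp_rw [h2] at h1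
  have hlim := (hF.tendsto_sub x).comp (tendsto_natCast_atTop_atTop (R := ℝ))
  have h3 := hasSum_of_summable_of_telescoping (G := fun n : ℕ => F n - F (n + x)) h1.summable
    (fun n => rfl) (l := 0) (by simpa using hlim.neg)
  have h4 := h1.unique h3
  simp only [Nat.cast_zero, zero_add] at h4
  linarith

lemma D_const_mul (F : ℝ → ℝ) (c x : ℝ) : D (fun y => c * F y) x = c * D F x := by
  simp only [D, ← tsum_mul_left, ← mul_sub, mul_div_assoc]

lemma D_const (c x : ℝ) : D (fun _ => c) x = 0 := by simp [D]

/-! ### Expansions at `0` with coefficients in the ring of zeta values -/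

/-- The subalgebra of `ℝ` over `ℚ` generated by the zeta values `ζ(t)`, `t ≥ 2`. -/
noncomputable def zetaAlg : Subalgebra ℚ ℝ :=
  Algebra.adjoin ℚ (Set.range fun t : ℕ => zetaValue (t + 2))

lemma zetaValue_mem {s : ℕ} (hs : 2 ≤ s) : zetaValue s ∈ zetaAlg := by
  obtain ⟨t, rfl⟩ := Nat.exists_eq_add_of_le' hs
  exact Algebra.subset_adjoin ⟨t, rfl⟩

lemma ratCast_mem_zetaAlg (q : ℚ) : (q : ℝ) ∈ zetaAlg := zetaAlg.algebraMap_mem q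

/-- `f` has an asymptotic expansion in powers of `t` as `t → 0`, with coefficients in
`zetaAlg`. -/
def HasExpansion (f : ℝ → ℝ) : Prop :=
  ∀ M : ℕ, ∃ q : Polynomial zetaAlg,
    (fun t : ℝ => f t - Polynomial.aeval t q) =O[𝓝[≠] 0] fun t : ℝ => t ^ M

lemma polynomial_isBigO_one (q : Polynomial zetaAlg) :
    (fun t : ℝ => Polynomial.aeval t q) =O[𝓝[≠] 0] fun _ : ℝ => (1 : ℝ) := by
  have h : ContinuousAt (fun t : ℝ => Polynomial.aeval t q) 0 :=
    (Polynomial.continuous_aeval q).continuousAt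
  exact (h.tendsto.mono_left nhdsWithin_le_nhds).isBigO_one ℝ

lemma HasExpansion.isBigO_one {f : ℝ → ℝ} (hf : HasExpansion f) :
    f =O[𝓝[≠] 0] fun _ : ℝ => (1 : ℝ) := by
  obtain ⟨q, hq⟩ := hf 0
  simp only [pow_zero] at hq
  exact (hq.add (polynomial_isBigO_one q)).congr_left fun t => by ring

lemma HasExpansion.of_polynomial (q : Polynomial zetaAlg) :
    HasExpansion fun t => Polynomial.aeval t q :=
  fun M => ⟨q, by simpa using isBigO_zero _ _⟩

lemma HasExpansion.add {f g : ℝ → ℝ} (hf : HasExpansion f) (hg : HasExpansion g) :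
    HasExpansion fun t => f t + g t := fun M => by
  obtain ⟨p, hp⟩ := hf M
  obtain ⟨q, hq⟩ := hg M
  exact ⟨p + q, (hp.add hq).congr_left fun t => by rw [map_add]; ring⟩

lemma HasExpansion.mul {f g : ℝ → ℝ} (hf : HasExpansion f) (hg : HasExpansion g) :
    HasExpansion fun t => f t * g t := fun M => by
  obtain ⟨p, hp⟩ := hf M
  obtain ⟨q, hq⟩ := hg M
  refine ⟨p * q, ?_⟩
  have h1 := hp.mul hg.isBigO_one
  have h2 := (polynomial_isBigO_one p).mul hq
  simp only [mul_one, one_mul] at h1 h2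
  exact (h1.add h2).congr_left fun t => by rw [map_mul]; ring

lemma HasExpansion.congr {f g : ℝ → ℝ} (hf : HasExpansion f) (h : f =ᶠ[𝓝[≠] 0] g) :
    HasExpansion g := fun M => by
  obtain ⟨p, hp⟩ := hf M
  refine ⟨p, hp.congr' ?_ (EventuallyEq.refl _ _)⟩
  filter_upwards [h] with t ht
  rw [ht]

lemma HasExpansion.pow_id (e : ℕ) : HasExpansion fun t => t ^ e := by
  simpa using HasExpansion.of_polynomial (Polynomial.X ^ e)

lemma HasExpansion.of_analyticAt {f : ℝ → ℝ} (hf : AnalyticAt ℝ f 0)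
    (h : ∀ n, iteratedDeriv n f 0 ∈ zetaAlg) : HasExpansion f := fun M => by
  have hp := (hf.hasFPowerSeriesAt).isBigO_sub_partialSum_pow M
  have hc : ∀ n, iteratedDeriv n f 0 / n.factorial ∈ zetaAlg := fun n => by
    have := zetaAlg.mul_mem (h n) (ratCast_mem_zetaAlg (n.factorial : ℚ)⁻¹)
    simpa [div_eq_mul_inv] using this
  refine ⟨∑ n ∈ Finset.range M, Polynomial.C ⟨_, hc n⟩ * Polynomial.X ^ n, ?_⟩
  have h2 := hp.mono (nhdsWithin_le_nhds (s := {0}ᶜ))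
  refine (h2.congr_left fun t => ?_).trans (IsBigO.of_bound 1 (by simp))
  simp only [zero_add, FormalMultilinearSeries.partialSum, map_sum, map_mul, map_pow,
    Polynomial.aeval_C, Polynomial.aeval_X, FormalMultilinearSeries.ofScalars_apply_eq]
  congr 1

/-- `f` has an asymptotic Laurent expansion as `t → 0`, with coefficients in `zetaAlg`. -/
def HasLaurent (f : ℝ → ℝ) : Prop := ∃ e : ℕ, HasExpansion fun t => t ^ e * f t

lemma HasExpansion.hasLaurent {f : ℝ → ℝ} (hf : HasExpansion f) : HasLaurent f :=
  ⟨0, by simpa using hf⟩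

lemma HasLaurent.congr {f g : ℝ → ℝ} (hf : HasLaurent f) (h : f =ᶠ[𝓝[≠] 0] g) :
    HasLaurent g := by
  obtain ⟨e, he⟩ := hf
  refine ⟨e, he.congr ?_⟩
  filter_upwards [h] with t ht
  rw [ht]

lemma HasLaurent.add {f g : ℝ → ℝ} (hf : HasLaurent f) (hg : HasLaurent g) :
    HasLaurent fun t => f t + g t := by
  obtain ⟨e, he⟩ := hf
  obtain ⟨d, hd⟩ := hg
  refine ⟨e + d, (((HasExpansion.pow_id d).mul he).add ((HasExpansion.pow_id e).mul hd)).congr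
    (Eventually.of_forall fun t => ?_)⟩
  simp only
  ring

lemma HasLaurent.mul {f g : ℝ → ℝ} (hf : HasLaurent f) (hg : HasLaurent g) :
    HasLaurent fun t => f t * g t := by
  obtain ⟨e, he⟩ := hf
  obtain ⟨d, hd⟩ := hg
  refine ⟨e + d, (he.mul hd).congr (Eventually.of_forall fun t => ?_)⟩
  simp only
  ring

lemma HasLaurent.const {c : ℝ} (hc : c ∈ zetaAlg) : HasLaurent fun _ => c := by
  have := HasExpansion.of_polynomial (Polynomial.C ⟨c, hc⟩)
  exact HasExpansion.hasLaurent (by simpa [Subalgebra.algebraMap_def] using this)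

/-- The functions with a Laurent expansion at `0` with coefficients in `zetaAlg`. -/
noncomputable def laurentAlg : Subalgebra ℚ (ℝ → ℝ) where
  carrier := {f | HasLaurent f}
  mul_mem' := HasLaurent.mul
  add_mem' := HasLaurent.add
  algebraMap_mem' q := HasLaurent.const (ratCast_mem_zetaAlg q)

lemma mem_laurentAlg {f : ℝ → ℝ} : f ∈ laurentAlg ↔ HasLaurent f := Iff.rfl

lemma coeff_zero_eq_zero_of_isLittleO {e : ℕ} {p : Polynomial ℝ}
    (h : (fun t : ℝ => p.eval t) =o[𝓝[≠] 0] fun t : ℝ => t ^ e) : p.coeff 0 = 0 := by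
  have h1 : Tendsto (fun t : ℝ => p.eval t) (𝓝[≠] 0) (𝓝 (p.eval 0)) :=
    (p.continuous.continuousAt (x := (0 : ℝ))).tendsto.mono_left nhdsWithin_le_nhds
  have h2 : Tendsto (fun t : ℝ => t ^ e) (𝓝[≠] 0) (𝓝 (0 ^ e)) :=
    ((continuous_pow e).continuousAt (x := (0 : ℝ))).tendsto.mono_left nhdsWithin_le_nhds
  have h3 := (h.trans_isBigO (h2.isBigO_one ℝ))
  rw [isLittleO_one_iff] at h3
  rw [Polynomial.coeff_zero_eq_eval_zero]
  exact tendsto_nhds_unique h1 h3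

lemma coeff_eq_zero_of_isLittleO {e : ℕ} {p : Polynomial ℝ}
    (h : (fun t : ℝ => p.eval t) =o[𝓝[≠] 0] fun t : ℝ => t ^ e) : p.coeff e = 0 := by
  induction e generalizing p with
  | zero => exact coeff_zero_eq_zero_of_isLittleO h
  | succ e ih =>
    rw [← Polynomial.coeff_divX]
    refine ih ?_
    have h0 := coeff_zero_eq_zero_of_isLittleO h
    have h5 := h.mul_isBigO (isBigO_refl (fun t : ℝ => t⁻¹) (𝓝[≠] 0))
    refine h5.congr' ?_ ?_
    · filter_upwards [self_mem_nhdsWithin] with t ht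
      have ht : t ≠ 0 := ht
      conv_lhs => rw [← p.divX_mul_X_add]
      simp [h0, ht]
    · filter_upwards [self_mem_nhdsWithin] with t ht
      have ht : t ≠ 0 := ht
      rw [pow_succ, mul_inv_cancel_right₀ ht]

/-- A finite limit must be the constant Laurent coefficient: after multiplication by `t^e` it is the
coefficient of `t^e` in the approximating polynomial, an element of `zetaAlg`. -/
lemma HasLaurent.mem_of_tendsto {f : ℝ → ℝ} (hf : HasLaurent f) {l : ℝ}
    (hl : Tendsto f (𝓝[≠] 0) (𝓝 l)) : l ∈ zetaAlg := by
  obtain ⟨e, he⟩ := hf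
  -- Order `e + 1` makes the error `o(t^e)`, just enough to read off the coefficient of `t^e`.
  obtain ⟨q, hq⟩ := he (e + 1)
  have h1 : (fun t : ℝ => t ^ (e + 1)) =o[𝓝[≠] 0] fun t : ℝ => t ^ e :=
    (isLittleO_pow_pow (𝕜 := ℝ) (Nat.lt_succ_self e)).mono nhdsWithin_le_nhds
  have h2 : (fun t : ℝ => t ^ e * (f t - l)) =o[𝓝[≠] 0] fun t : ℝ => t ^ e := by
    have h3 : (fun t => f t - l) =o[𝓝[≠] 0] fun _ : ℝ => (1 : ℝ) := by
      rw [isLittleO_one_iff]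
      simpa using hl.sub_const l
    simpa using (isBigO_refl (fun t : ℝ => t ^ e) (𝓝[≠] 0)).mul_isLittleO h3
  have h4 := h2.sub (hq.trans_isLittleO h1)
  have h5 := coeff_eq_zero_of_isLittleO (e := e)
    (p := q.map (algebraMap zetaAlg ℝ) - Polynomial.C l * Polynomial.X ^ e)
    (h4.congr_left fun t => by
      simp only [Polynomial.eval_sub, Polynomial.eval_mul, Polynomial.eval_C, Polynomial.eval_pow,
        Polynomial.eval_X, Polynomial.eval_map_algebraMap]
      ring)
  simp only [Polynomial.coeff_sub, Polynomial.coeff_map, Polynomial.coeff_C_mul,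
    Polynomial.coeff_X_pow, if_true, mul_one, Subalgebra.algebraMap_def] at h5
  rw [← sub_eq_zero.1 h5]
  exact (q.coeff e).2

/-- Repeated use of `H_s' = s (ζ(s+1) - H_{s+1})`, together with `H_s(0) = 0`, expresses every
derivative at `0` through zeta values. -/
lemma HasExpansion.H {s : ℕ} (hs : 1 ≤ s) : HasExpansion (H s) := by
  refine .of_analyticAt (analyticAt_H hs (.of_pos (by norm_num))) fun n => ?_
  induction n generalizing s with
  | zero => simp [H_zero hs]
  | succ n ih =>
    have hs' : (s : ℝ) ∈ zetaAlg := by simp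
    obtain ⟨c, hc, hcs⟩ : ∃ c ∈ zetaAlg, c = s * zetaValue (s + 1) :=
      ⟨_, zetaAlg.mul_mem hs' (zetaValue_mem (by omega)), rfl⟩
    have h1 : deriv (ShiftedHarmonic.H s) =ᶠ[𝓝 0]
        fun y => c - s * ShiftedHarmonic.H (s + 1) y := by
      filter_upwards [lt_mem_nhds (show (-1 : ℝ) < 0 by norm_num)] with y hy
      rw [(hasDerivAt_H hs hy).deriv, hcs]
      ring
    rw [iteratedDeriv_succ', h1.iteratedDeriv_eq]
    have h2 : AnalyticAt ℝ (ShiftedHarmonic.H (s + 1)) 0 :=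
      analyticAt_H (by omega) (.of_pos (by norm_num))
    rw [iteratedDeriv_fun_sub contDiffAt_const (contDiffAt_const.mul h2.contDiffAt),
      iteratedDeriv_const_mul_field, iteratedDeriv_const]
    refine zetaAlg.sub_mem ?_ (zetaAlg.mul_mem hs' (ih (by omega)))
    split_ifs
    · exact hc
    · exact zetaAlg.zero_mem

lemma HasLaurent.inv_add_int (c : ℤ) : HasLaurent fun t => (t + c)⁻¹ := by
  rcases eq_or_ne c 0 with rfl | hc
  · refine ⟨1, (HasExpansion.pow_id 0).congr ?_⟩
    filter_upwards [self_mem_nhdsWithin] with t ht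
    have ht : t ≠ 0 := ht
    simp [ht]
  · have hc' : (0 : ℝ) + c ≠ 0 := by simpa using hc
    refine HasExpansion.hasLaurent (.of_analyticAt ?_ fun n => ?_)
    · exact (analyticAt_id.add analyticAt_const).inv hc'
    · rw [congrFun (iteratedDeriv_comp_add_const n (fun z : ℝ => z⁻¹) (c : ℝ)) 0, iteratedDeriv_inv]
      have := ratCast_mem_zetaAlg ((-1) ^ n * n.factorial * ((c : ℚ) ^ (n + 1))⁻¹)
      simpa using this

lemma eventually_nonPole_add_int (c : ℤ) : ∀ᶠ t : ℝ in 𝓝[≠] 0, NonPole (t + c) := by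
  have h1 : ∀ᶠ t : ℝ in 𝓝[≠] 0, |t| < 1 :=
    nhdsWithin_le_nhds ((continuous_abs.tendsto (0 : ℝ)).eventually_lt_const (by simp))
  filter_upwards [h1, self_mem_nhdsWithin] with t ht ht0 j hj
  have ht0 : t ≠ 0 := ht0
  have e : t = ((-j - c : ℤ) : ℝ) := by push_cast; linarith
  rw [e] at ht ht0
  have h2 : |(-j - c : ℤ)| < 1 := by exact_mod_cast ht
  rw [Int.abs_lt_one_iff] at h2
  rw [h2] at ht0
  simp at ht0

/-- The unit-step recurrence adds or removes the rational function `(t+d)^{-s}`, so poles are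
reached from the expansion at `0`. -/
lemma HasLaurent.H_add_int {s : ℕ} (hs : 1 ≤ s) (c : ℤ) : HasLaurent fun t => H s (t + c) := by
  have hinv : ∀ d : ℤ, HasLaurent fun t => ((t + d) ^ s)⁻¹ := fun d => by
    have := laurentAlg.pow_mem (mem_laurentAlg.2 (HasLaurent.inv_add_int d)) s
    refine (mem_laurentAlg.1 this).congr (Eventually.of_forall fun t => ?_)
    simp
  induction c using Int.induction_on with
  | zero => simpa using (HasExpansion.H hs).hasLaurent
  | succ c ih =>
    refine (ih.add (hinv (c + 1))).congr ?_
    filter_upwards [eventually_nonPole_add_int (c + 1)] with t ht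
    push_cast at ht ⊢
    rw [← add_assoc] at ht ⊢
    rw [H_add_one hs ht]
  | pred c ih =>
    refine (ih.add ((HasLaurent.const (ratCast_mem_zetaAlg (-1))).mul (hinv (-c)))).congr ?_
    filter_upwards [eventually_nonPole_add_int (-c)] with t ht
    push_cast at ht ⊢
    rw [← add_sub_assoc, H_sub_one hs ht]
    ring

/-! ### Continuity of the sums in the parameter -/

lemma tendsto_tsum_of_eventually_bounded {α : Type*} {l : Filter α} {f : α → ℕ → ℝ} {g b : ℕ → ℝ}
    (hb : Summable b) (hf : ∀ n, Tendsto (fun x => f x n) l (𝓝 (g n)))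
    (N : ℕ) (hN : ∀ᶠ x in l, ∀ n, N ≤ n → |f x n| ≤ b n) :
    Tendsto (fun x => ∑' n, f x n) l (𝓝 (∑' n, g n)) := by
  refine tendsto_tsum_of_dominated_convergence (bound := fun n => if n < N then |g n| + 1 else b n)
    ?_ hf ?_
  · refine (summable_nat_add_iff N).1 (((summable_nat_add_iff N).2 hb).congr fun n => ?_)
    simp
  · have h1 : ∀ᶠ x in l, ∀ n ∈ Finset.range N, |f x n| < |g n| + 1 := by
      rw [eventually_all_finset]
      intro n _
      exact (hf n).abs.eventually_lt_const (by linarith)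
    filter_upwards [h1, hN] with x hx1 hx2 n
    rw [Real.norm_eq_abs]
    split_ifs with hn
    · exact (hx1 n (Finset.mem_range.2 hn)).le
    · exact hx2 n (by omega)

lemma tendsto_tsum_comp_add_mul {φ : ℝ → ℝ} {p q : ℝ} (hφ : φ =O[atTop] fun y => y ^ p) {w : ℕ → ℝ}
    (hw : ∀ n : ℕ, |w n| ≤ ((n : ℝ) + 1) ^ q) (hpq : p + q < -1) {x₀ : ℝ}
    (hc : ∀ n : ℕ, ContinuousAt φ (n + 1 + x₀)) :
    Tendsto (fun x => ∑' n : ℕ, φ (n + 1 + x) * w n) (𝓝 x₀)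
      (𝓝 (∑' n : ℕ, φ (n + 1 + x₀) * w n)) := by
  obtain ⟨C, hC⟩ := hφ.bound
  obtain ⟨Y, hY⟩ := eventually_atTop.1 hC
  -- For `n ≥ N` and `|x - x₀| < 1`, this puts `n + 1 + x` beyond `Y` and within a factor `2` of `n
  -- + 1`, whence the constant `2^|p|` for either sign of `p`.
  obtain ⟨N, hN⟩ := exists_nat_ge (|Y| * 2 + 2 * (|x₀| + 1))
  have hC0 : 0 ≤ |C| := abs_nonneg C
  refine tendsto_tsum_of_eventually_bounded (N := N)
    (b := fun n : ℕ => |C| * (2 : ℝ) ^ |p| * ((n : ℝ) + 1) ^ (p + q)) ?_ ?_ ?_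
  · refine Summable.mul_left _ ?_
    have := (summable_nat_add_iff 1).2 (Real.summable_nat_rpow.2 hpq)
    simpa using this
  · intro n
    exact (((hc n).tendsto.comp (tendsto_const_nhds.add tendsto_id)).mul_const _)
  · have h1 : ∀ᶠ x in 𝓝 x₀, |x - x₀| < 1 := by
      have : Tendsto (fun x => |x - x₀|) (𝓝 x₀) (𝓝 |x₀ - x₀|) :=
        (continuous_abs.comp (continuous_sub_right x₀)).tendsto x₀
      exact this.eventually_lt_const (by simp)
    filter_upwards [h1] with x hx n hn
    have hn' : (N : ℝ) ≤ n := by exact_mod_cast hn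
    have hx1 := abs_lt.1 hx
    have hx2 := abs_le.1 (le_refl |x₀|)
    have hn0 : (0 : ℝ) < n + 1 := by positivity
    have hY' := le_abs_self Y
    have hY0 := abs_nonneg Y
    have hlow : ((n : ℝ) + 1) / 2 ≤ n + 1 + x := by linarith
    have hup : (n : ℝ) + 1 + x ≤ 2 * (n + 1) := by linarith
    have hy0 : 0 < (n : ℝ) + 1 + x := by linarith
    have h2 := hY (n + 1 + x) (by linarith)
    rw [Real.norm_eq_abs, Real.norm_of_nonneg (by positivity)] at h2
    have h3 : ((n : ℝ) + 1 + x) ^ p ≤ 2 ^ |p| * ((n : ℝ) + 1) ^ p := by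
      rcases le_total 0 p with hp | hp
      · rw [abs_of_nonneg hp, ← Real.mul_rpow (by norm_num) hn0.le]
        exact Real.rpow_le_rpow hy0.le hup hp
      · rw [abs_of_nonpos hp, Real.rpow_neg (by norm_num), ← Real.inv_rpow (by norm_num),
          ← Real.mul_rpow (by norm_num) hn0.le]
        refine Real.rpow_le_rpow_of_nonpos (by positivity) ?_ hp
        linarith
    calc |φ (n + 1 + x) * w n| ≤ (|C| * (2 ^ |p| * ((n : ℝ) + 1) ^ p)) * ((n : ℝ) + 1) ^ q := by
          rw [abs_mul]
          refine mul_le_mul (h2.trans ?_) (hw n) (abs_nonneg _) (by positivity)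
          exact mul_le_mul (le_abs_self C) h3 (by positivity) hC0
      _ = _ := by rw [Real.rpow_add hn0]; ring

lemma Decays.tendsto_J {g : ℝ → ℝ} (hg : Decays g) {x₀ : ℝ}
    (hc : ∀ n : ℕ, ContinuousAt g (n + 1 + x₀)) : Tendsto (J g) (𝓝 x₀) (𝓝 (J g x₀)) := by
  have := tendsto_tsum_comp_add_mul (q := -1) hg (w := fun n : ℕ => ((n : ℝ) + 1)⁻¹) (fun n => ?_)
    (by norm_num) hc
  · have e : J g = fun x => ∑' n : ℕ, g (n + 1 + x) * ((n : ℝ) + 1)⁻¹ := by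
      funext x
      simp only [J, div_eq_mul_inv]
    rwa [e]
  · rw [Real.rpow_neg_one, abs_of_pos (by positivity)]

/-! ### Evaluation of `J` and `D` for products of harmonic functions -/

lemma bdiff_H {m : ℕ} (hm : 1 ≤ m) {y : ℝ} (hy : NonPole y) : bdiff (H m) y = (y ^ m)⁻¹ := by
  rw [bdiff, H_sub_one hm hy]
  ring

lemma J_bdiff_H {m : ℕ} (hm : 1 ≤ m) {x : ℝ} (hx : NonPole (x + 1)) :
    J (bdiff (H m)) x = J (fun y => (y ^ m)⁻¹) x :=
  J_congr hx fun _ => bdiff_H hm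

lemma decays_inv_pow {m : ℕ} (hm : 1 ≤ m) : Decays fun y => (y ^ m)⁻¹ := by
  simpa using Decays.mul_inv_pow (Slow.const 1) hm

lemma decays_H_div {s : ℕ} (hs : 1 ≤ s) : Decays fun y => H s y / y := by
  simpa [div_eq_mul_inv] using Decays.mul_inv_pow (Slow.H hs) (le_refl 1)

lemma J_inv_pow_zero {m : ℕ} (hm : 1 ≤ m) : J (fun y => (y ^ m)⁻¹) 0 = zetaValue (m + 1) := by
  rw [← (hasSum_zetaValue (s := m + 1) (by omega)).tsum_eq, J]
  refine tsum_congr fun n => ?_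
  rw [add_zero, pow_succ, mul_inv, div_eq_mul_inv]

lemma mul_J_inv {x : ℝ} (hx : NonPole (x + 1)) : x * J (fun y => (y ^ 1)⁻¹) x = H 1 x := by
  have h := mul_J_bdiff (F := H 1) (F₁ := fun _ => 1) (S := fun _ => 0) (Slow.H le_rfl)
    (Slow.const 1) (isBigO_zero _ _) (fun y hy => by rw [bdiff_H le_rfl hy]; simp) hx
  rw [J_bdiff_H le_rfl hx, D_const, H_zero le_rfl] at h
  simpa [J] using h

lemma mul_J_inv_pow_succ {m : ℕ} (hm : 1 ≤ m) {x : ℝ} (hx : NonPole (x + 1)) :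
    x * J (fun y => (y ^ (m + 1))⁻¹) x
      = H (m + 1) x + J (fun y => (y ^ m)⁻¹) x - zetaValue (m + 1) := by
  have h := mul_J_bdiff (F := H (m + 1)) (F₁ := fun _ => 0) (S := fun y => (y ^ m)⁻¹)
    (Slow.H (by omega)) (Slow.const 0) (decays_inv_pow hm)
    (fun y hy => by
      have := hy.ne_zero
      rw [bdiff_H (by omega) hy]
      field_simp
      ring) hx
  rw [J_bdiff_H (by omega) hx, D_const, H_zero (by omega), J_inv_pow_zero hm] at h
  linarith

lemma J_inv_eq {x : ℝ} (hx : NonPole x) : J (fun y => (y ^ 1)⁻¹) x = H 1 x / x := by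
  rw [← mul_J_inv hx.add_one, mul_div_cancel_left₀ _ hx.ne_zero]

lemma J_inv_sq_eq {x : ℝ} (hx : NonPole x) :
    J (fun y => (y ^ 2)⁻¹) x = (H 2 x + H 1 x / x - zetaValue 2) / x := by
  have h := mul_J_inv_pow_succ le_rfl hx.add_one
  rw [J_inv_eq hx] at h
  rw [eq_div_iff hx.ne_zero, mul_comm]
  exact h

/-- The right side is an antidifference of `J(ΔH)(x) = H_x / x` vanishing at `0`; uniqueness does
the rest. The later formulas for `D` arise in the same way. -/
lemma D_H_one {x : ℝ} (hx : NonPole (x + 1)) : D (H 1) x = (H 1 x ^ 2 + H 2 x) / 2 := by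
  have s1 : Slow (H 1) := Slow.H le_rfl
  have s2 : Slow (H 2) := Slow.H (by norm_num)
  refine eq_of_monotoneOn_of_slow (C := fun x => (H 1 x ^ 2 + H 2 x) / 2)
    (s1.D_monotoneOn (H_monotoneOn le_rfl)) ?_ (fun x hx => ?_) ?_ hx
  · simpa [div_eq_inv_mul] using ((s1.pow 2).add s2).const_mul (2⁻¹)
  · rw [s1.D_sub, J_bdiff_H le_rfl hx.add_one, J_inv_eq hx, H_sub_one le_rfl hx,
      H_sub_one (by norm_num) hx]
    have := hx.ne_zero
    field_simp
    ring
  · simp [D_zero, H_zero]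

lemma D_H_two {x : ℝ} (hx : NonPole (x + 1)) :
    D (H 2) x = H 1 x * H 2 x + H 3 x - zetaValue 2 * H 1 x := by
  have s1 : Slow (H 1) := Slow.H le_rfl
  have s2 : Slow (H 2) := Slow.H (by norm_num)
  have s3 : Slow (H 3) := Slow.H (by norm_num)
  refine eq_of_monotoneOn_of_slow (C := fun x => H 1 x * H 2 x + H 3 x - zetaValue 2 * H 1 x)
    (s2.D_monotoneOn (H_monotoneOn (by norm_num)))
    (((s1.mul s2).add s3).sub (s1.const_mul _)) (fun x hx => ?_) ?_ hx
  · rw [s2.D_sub, J_bdiff_H (by norm_num) hx.add_one, J_inv_sq_eq hx, H_sub_one le_rfl hx,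
      H_sub_one (by norm_num) hx, H_sub_one (by norm_num) hx]
    have := hx.ne_zero
    field_simp
    ring
  · simp [D_zero, H_zero]

lemma slow_H_sq : Slow fun y => H 1 y ^ 2 := (Slow.H le_rfl).pow 2

lemma slow_H_cube : Slow fun y => H 1 y ^ 3 := (Slow.H le_rfl).pow 3

lemma slow_H_mul_H_two : Slow fun y => H 1 y * H 2 y := (Slow.H le_rfl).mul (Slow.H (by norm_num))

lemma slow_H_sq_mul_H_two : Slow fun y => H 1 y ^ 2 * H 2 y := slow_H_sq.mul (Slow.H (by norm_num))

lemma bdiff_H_sq {y : ℝ} (hy : NonPole y) :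
    bdiff (fun y => H 1 y ^ 2) y = 2 * (H 1 y / y) + (-1) * (y ^ 2)⁻¹ := by
  have := hy.ne_zero
  rw [bdiff, H_sub_one le_rfl hy]
  field_simp
  ring

lemma mul_J_bdiff_H_sq {x : ℝ} (hx : NonPole (x + 1)) :
    x * J (bdiff fun y => H 1 y ^ 2) x
      = 2 * H 1 x ^ 2 + H 2 x + zetaValue 2 - J (fun y => (y ^ 1)⁻¹) x := by
  have h := mul_J_bdiff (F := fun y => H 1 y ^ 2) (F₁ := fun y => 2 * H 1 y)
    (S := fun y => (-1) * (y ^ 1)⁻¹) slow_H_sq ((Slow.H le_rfl).const_mul 2)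
    ((decays_inv_pow le_rfl).const_mul _)
    (fun y hy => by
      have := hy.ne_zero
      rw [bdiff_H_sq hy]
      field_simp) hx
  rw [D_const_mul, D_H_one hx, H_zero le_rfl, J_const_mul, J_const_mul, J_inv_pow_zero le_rfl] at h
  rw [h]
  ring

lemma J_H_div {x : ℝ} (hx : NonPole (x + 1)) : J (fun y => H 1 y / y) x
    = (J (bdiff fun y => H 1 y ^ 2) x + J (fun y => (y ^ 2)⁻¹) x) / 2 := by
  have h1 : J (bdiff fun y => H 1 y ^ 2) x
      = J (fun y => 2 * (H 1 y / y) + (-1) * (y ^ 2)⁻¹) x := J_congr hx fun y => bdiff_H_sq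
  rw [h1, J_add ((decays_H_div le_rfl).const_mul _) ((decays_inv_pow (by norm_num)).const_mul _),
    J_const_mul, J_const_mul]
  ring

lemma J_H_div_eq {x : ℝ} (hx : NonPole x) :
    J (fun y => H 1 y / y) x = (H 1 x ^ 2 + H 2 x) / x := by
  have h := mul_J_bdiff_H_sq hx.add_one
  have h0 := hx.ne_zero
  rw [J_inv_eq hx, mul_comm, ← eq_div_iff h0] at h
  rw [J_H_div hx.add_one, h, J_inv_sq_eq hx]
  field_simp
  ring

lemma D_H_sq {x : ℝ} (hx : NonPole (x + 1)) : D (fun y => H 1 y ^ 2) x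
    = 2 / 3 * H 1 x ^ 3 + H 1 x * H 2 x + zetaValue 2 * H 1 x + 1 / 3 * H 3 x := by
  have s1 : Slow (H 1) := Slow.H le_rfl
  have s3 : Slow (H 3) := Slow.H (by norm_num)
  refine eq_of_monotoneOn_of_slow
    (C := fun x => 2 / 3 * H 1 x ^ 3 + H 1 x * H 2 x + zetaValue 2 * H 1 x + 1 / 3 * H 3 x)
    (slow_H_sq.D_monotoneOn fun a ha b hb h =>
      pow_le_pow_left₀ (H_nonneg le_rfl ha) (H_monotoneOn le_rfl ha hb h) 2)
    ((((slow_H_cube.const_mul _).add slow_H_mul_H_two).add (s1.const_mul _)).add (s3.const_mul _))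
    (fun x hx => ?_) ?_ hx
  · have h := mul_J_bdiff_H_sq hx.add_one
    have h0 := hx.ne_zero
    rw [J_inv_eq hx, mul_comm, ← eq_div_iff h0] at h
    rw [slow_H_sq.D_sub, h, H_sub_one le_rfl hx, H_sub_one (by norm_num) hx,
      H_sub_one (by norm_num) hx]
    field_simp
    ring
  · simp [D_zero, H_zero]

/-- The remainder in the difference of `H 1 * H 2`. -/
noncomputable def remMul (y : ℝ) : ℝ := H 1 y / y + (-1) * (y ^ 2)⁻¹

lemma decays_remMul : Decays remMul :=
  (decays_H_div le_rfl).add ((decays_inv_pow (by norm_num)).const_mul _)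

lemma J_remMul (x : ℝ) : J remMul x = J (fun y => H 1 y / y) x - J (fun y => (y ^ 2)⁻¹) x := by
  unfold remMul
  rw [J_add (decays_H_div le_rfl) ((decays_inv_pow (by norm_num)).const_mul _), J_const_mul]
  ring

lemma bdiff_H_mul_H_two {y : ℝ} (hy : NonPole y) :
    bdiff (fun y => H 1 y * H 2 y) y = (H 2 y + remMul y) / y := by
  have := hy.ne_zero
  rw [bdiff, H_sub_one le_rfl hy, H_sub_one (by norm_num) hy, remMul]
  field_simp
  ring

lemma mul_J_bdiff_H_mul_H_two {x : ℝ} (hx : NonPole (x + 1)) :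
    x * J (bdiff fun y => H 1 y * H 2 y) x
      = 2 * H 1 x * H 2 x + H 3 x - zetaValue 2 * H 1 x + (J remMul x - J remMul 0) := by
  rw [mul_J_bdiff (F₁ := H 2) slow_H_mul_H_two (Slow.H (by norm_num)) decays_remMul
    (fun y => bdiff_H_mul_H_two) hx, D_H_two hx, H_zero le_rfl]
  ring

/-- The Euler sum `J remMul 0` is left unevaluated, since only its membership in `zetaAlg` matters.
-/
lemma D_H_mul_H_two {x : ℝ} (hx : NonPole (x + 1)) : D (fun y => H 1 y * H 2 y) x
    = H 1 x ^ 2 * H 2 x + H 1 x * H 3 x + 1 / 2 * H 2 x ^ 2 + 1 / 2 * H 4 x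
      + zetaValue 2 / 2 * (H 2 x - H 1 x ^ 2) - J remMul 0 * H 1 x := by
  have s1 : Slow (H 1) := Slow.H le_rfl
  have s2 : Slow (H 2) := Slow.H (by norm_num)
  have s3 : Slow (H 3) := Slow.H (by norm_num)
  have s4 : Slow (H 4) := Slow.H (by norm_num)
  refine eq_of_monotoneOn_of_slow
    (C := fun x => H 1 x ^ 2 * H 2 x + H 1 x * H 3 x + 1 / 2 * H 2 x ^ 2 + 1 / 2 * H 4 x
      + zetaValue 2 / 2 * (H 2 x - H 1 x ^ 2) - J remMul 0 * H 1 x)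
    (slow_H_mul_H_two.D_monotoneOn fun a ha b hb h =>
      mul_le_mul (H_monotoneOn le_rfl ha hb h) (H_monotoneOn (by norm_num) ha hb h)
        (H_nonneg (by norm_num) ha) (H_nonneg le_rfl hb))
    (((((slow_H_sq_mul_H_two.add (s1.mul s3)).add ((s2.pow 2).const_mul _)).add
      (s4.const_mul _)).add ((s2.sub slow_H_sq).const_mul _)).sub (s1.const_mul _))
    (fun x hx => ?_) ?_ hx
  · have h := mul_J_bdiff_H_mul_H_two hx.add_one
    have h0 := hx.ne_zero
    rw [mul_comm, ← eq_div_iff h0] at h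
    rw [slow_H_mul_H_two.D_sub, h, J_remMul x, J_H_div_eq hx, J_inv_sq_eq hx, H_sub_one le_rfl hx,
      H_sub_one (by norm_num) hx, H_sub_one (by norm_num) hx, H_sub_one (by norm_num) hx]
    field_simp
    ring
  · simp [D_zero, H_zero]

/-- The remainder in the difference of `H 1 ^ 3`. -/
noncomputable def remCube (y : ℝ) : ℝ := (-3) * (H 1 y / y) + (y ^ 2)⁻¹

lemma decays_remCube : Decays remCube :=
  ((decays_H_div le_rfl).const_mul _).add (decays_inv_pow (by norm_num))

lemma J_remCube (x : ℝ) :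
    J remCube x = (-3) * J (fun y => H 1 y / y) x + J (fun y => (y ^ 2)⁻¹) x := by
  unfold remCube
  rw [J_add ((decays_H_div le_rfl).const_mul _) (decays_inv_pow (by norm_num)), J_const_mul]

lemma mul_J_bdiff_H_cube {x : ℝ} (hx : NonPole (x + 1)) :
    x * J (bdiff fun y => H 1 y ^ 3) x
      = 3 * (D (fun y => H 1 y ^ 2) x) + H 1 x ^ 3 + (J remCube x - J remCube 0) := by
  rw [mul_J_bdiff (F₁ := fun y => 3 * H 1 y ^ 2) slow_H_cube (slow_H_sq.const_mul _) decays_remCube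
    (fun y hy => ?_) hx, D_const_mul, H_zero le_rfl]
  · ring
  · have := hy.ne_zero
    rw [bdiff, H_sub_one le_rfl hy, remCube]
    field_simp
    ring

/-- The remainder in the difference of `H 1 ^ 2 * H 2`. -/
noncomputable def remSqMul (y : ℝ) : ℝ :=
  1 / 3 * bdiff (fun y => H 1 y ^ 3) y
    + ((-1) * bdiff (fun y => H 1 y * H 2 y) y + (-1 / 3) * (y ^ 3)⁻¹)

lemma decays_remSqMul : Decays remSqMul :=
  (slow_H_cube.decays_bdiff.const_mul _).add ((slow_H_mul_H_two.decays_bdiff.const_mul _).add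
    ((decays_inv_pow (by norm_num)).const_mul _))

lemma J_remSqMul (x : ℝ) : J remSqMul x = 1 / 3 * J (bdiff fun y => H 1 y ^ 3) x
    + ((-1) * J (bdiff fun y => H 1 y * H 2 y) x + (-1 / 3) * J (fun y => (y ^ 3)⁻¹) x) := by
  unfold remSqMul
  rw [J_add (slow_H_cube.decays_bdiff.const_mul _) ((slow_H_mul_H_two.decays_bdiff.const_mul _).add
    ((decays_inv_pow (by norm_num)).const_mul _)), J_add (slow_H_mul_H_two.decays_bdiff.const_mul _)
    ((decays_inv_pow (by norm_num)).const_mul _), J_const_mul, J_const_mul, J_const_mul]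

/-- The remainder is `H_1²/y - 2H_1/y² - H_2/y + 1/y³`. Its terms are not summed separately:
`H_1²/y` comes from `Δ(H_1³)`, and the remaining `H_1/y²` and `H_2/y` occur exactly in the
combination supplied by `Δ(H_1 H_2)`. This is why `remSqMul` is built from differences already
treated. -/
lemma mul_J_bdiff_H_sq_mul_H_two {x : ℝ} (hx : NonPole (x + 1)) :
    x * J (bdiff fun y => H 1 y ^ 2 * H 2 y) x
      = 2 * (D (fun y => H 1 y * H 2 y) x) + H 1 x ^ 2 * H 2 x
        + (J remSqMul x - J remSqMul 0) := by
  rw [mul_J_bdiff (F₁ := fun y => 2 * (H 1 y * H 2 y)) slow_H_sq_mul_H_two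
    (slow_H_mul_H_two.const_mul _) decays_remSqMul (fun y hy => ?_) hx, D_const_mul, H_zero le_rfl]
  · ring
  · have := hy.ne_zero
    simp only [bdiff, H_sub_one le_rfl hy, H_sub_one (m := 2) (by norm_num) hy, remSqMul]
    field_simp
    ring

/-! ### Closed forms of `J` and their constants -/

/-- The algebra of functions generated over `ℚ` by the harmonic functions `H s`, the zeta values
and `x⁻¹`. -/
noncomputable def harmonicAlg : Subalgebra ℚ (ℝ → ℝ) :=
  Algebra.adjoin ℚ ({f | ∃ s, 1 ≤ s ∧ f = H s} ∪ {f | ∃ c ∈ zetaAlg, f = fun _ => c} ∪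
    {fun x => x⁻¹})

/-- `f` agrees with an element of `harmonicAlg` off the poles `0, -1, -2, …`. -/
def IsHarmonic (f : ℝ → ℝ) : Prop := ∃ g ∈ harmonicAlg, ∀ x, NonPole x → f x = g x

lemma IsHarmonic.H {s : ℕ} (hs : 1 ≤ s) : IsHarmonic (H s) :=
  ⟨_, Algebra.subset_adjoin (Or.inl (Or.inl ⟨s, hs, rfl⟩)), fun _ _ => rfl⟩

lemma IsHarmonic.const {c : ℝ} (hc : c ∈ zetaAlg) : IsHarmonic fun _ => c :=
  ⟨_, Algebra.subset_adjoin (Or.inl (Or.inr ⟨c, hc, rfl⟩)), fun _ _ => rfl⟩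

lemma IsHarmonic.ratCast (q : ℚ) : IsHarmonic fun _ => (q : ℝ) := .const (ratCast_mem_zetaAlg q)

lemma IsHarmonic.inv : IsHarmonic fun x => x⁻¹ :=
  ⟨_, Algebra.subset_adjoin (Or.inr rfl), fun _ _ => rfl⟩

lemma IsHarmonic.add {f g : ℝ → ℝ} (hf : IsHarmonic f) (hg : IsHarmonic g) :
    IsHarmonic fun x => f x + g x := by
  obtain ⟨f', hf', ef⟩ := hf
  obtain ⟨g', hg', eg⟩ := hg
  exact ⟨f' + g', harmonicAlg.add_mem hf' hg', fun x hx => by simp [ef x hx, eg x hx]⟩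

lemma IsHarmonic.mul {f g : ℝ → ℝ} (hf : IsHarmonic f) (hg : IsHarmonic g) :
    IsHarmonic fun x => f x * g x := by
  obtain ⟨f', hf', ef⟩ := hf
  obtain ⟨g', hg', eg⟩ := hg
  exact ⟨f' * g', harmonicAlg.mul_mem hf' hg', fun x hx => by simp [ef x hx, eg x hx]⟩

lemma IsHarmonic.congr {f g : ℝ → ℝ} (hf : IsHarmonic f) (h : ∀ x, NonPole x → g x = f x) :
    IsHarmonic g := by
  obtain ⟨f', hf', ef⟩ := hf
  exact ⟨f', hf', fun x hx => (h x hx).trans (ef x hx)⟩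

lemma IsHarmonic.const_mul {f : ℝ → ℝ} (hf : IsHarmonic f) {c : ℝ} (hc : c ∈ zetaAlg) :
    IsHarmonic fun x => c * f x := (IsHarmonic.const hc).mul hf

lemma IsHarmonic.rat_mul {f : ℝ → ℝ} (hf : IsHarmonic f) (q : ℚ) :
    IsHarmonic fun x => (q : ℝ) * f x := (IsHarmonic.ratCast q).mul hf

lemma IsHarmonic.sub {f g : ℝ → ℝ} (hf : IsHarmonic f) (hg : IsHarmonic g) :
    IsHarmonic fun x => f x - g x :=
  (hf.add (hg.rat_mul (-1))).congr fun x _ => by push_cast; ring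

lemma IsHarmonic.pow {f : ℝ → ℝ} (hf : IsHarmonic f) (n : ℕ) : IsHarmonic fun x => f x ^ n := by
  obtain ⟨f', hf', ef⟩ := hf
  exact ⟨f' ^ n, harmonicAlg.pow_mem hf' n, fun x hx => by simp [ef x hx]⟩

lemma IsHarmonic.of_mul {f g : ℝ → ℝ} (hg : IsHarmonic g) (h : ∀ x, NonPole x → x * f x = g x) :
    IsHarmonic f :=
  (IsHarmonic.inv.mul hg).congr fun x hx => by
    rw [← h x hx, inv_mul_cancel_left₀ hx.ne_zero]

lemma harmonicAlg_le_laurentAlg : harmonicAlg ≤ laurentAlg := by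
  refine Algebra.adjoin_le ?_
  rintro f ((⟨s, hs, rfl⟩ | ⟨c, hc, rfl⟩) | rfl)
  · exact (HasExpansion.H hs).hasLaurent
  · exact HasLaurent.const hc
  · exact (HasLaurent.inv_add_int 0).congr (Eventually.of_forall fun t => by simp)

lemma IsHarmonic.mem_of_tendsto {f : ℝ → ℝ} (hf : IsHarmonic f) {l : ℝ}
    (hl : Tendsto f (𝓝[≠] 0) (𝓝 l)) : l ∈ zetaAlg := by
  obtain ⟨g, hg, h⟩ := hf
  refine HasLaurent.mem_of_tendsto (harmonicAlg_le_laurentAlg hg) (hl.congr' ?_)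
  filter_upwards [eventually_nonPole_add_int 0] with t ht
  exact h t (by simpa using ht)

lemma continuousAt_H {s : ℕ} (hs : 1 ≤ s) {y : ℝ} (hy : NonPole (y + 1)) : ContinuousAt (H s) y :=
  (analyticAt_H hs hy).continuousAt

/-- The closed form involves division by `x` and says nothing at `x = 0`; continuity of `J g`
recovers the value there as a limit. -/
lemma IsHarmonic.J_zero_mem {g : ℝ → ℝ} (hJ : IsHarmonic (J g)) (hg : Decays g)
    (hc : ∀ y, 0 < y → ContinuousAt g y) : J g 0 ∈ zetaAlg :=
  hJ.mem_of_tendsto ((hg.tendsto_J fun n => hc (n + 1 + 0) (by rw [add_zero]; positivity)).mono_left nhdsWithin_le_nhds)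

lemma isHarmonic_J_inv_pow {m : ℕ} (hm : 1 ≤ m) : IsHarmonic (J fun y => (y ^ m)⁻¹) := by
  induction m, hm using Nat.le_induction with
  | base => exact .of_mul (.H le_rfl) fun x hx => mul_J_inv hx.add_one
  | succ m hm ih =>
    exact .of_mul (((IsHarmonic.H (by omega)).add ih).sub (.const (zetaValue_mem (by omega))))
      fun x hx => mul_J_inv_pow_succ hm hx.add_one

lemma isHarmonic_J_bdiff_H {m : ℕ} (hm : 1 ≤ m) : IsHarmonic (J (bdiff (H m))) :=
  (isHarmonic_J_inv_pow hm).congr fun _ hx => J_bdiff_H hm hx.add_one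

lemma isHarmonic_J_bdiff_H_sq : IsHarmonic (J (bdiff fun y => H 1 y ^ 2)) :=
  .of_mul ((((((IsHarmonic.H le_rfl).pow 2).rat_mul 2).add (.H (s := 2) (by norm_num))).add
    (.const (zetaValue_mem le_rfl))).sub (isHarmonic_J_inv_pow le_rfl))
    fun x hx => by rw [mul_J_bdiff_H_sq hx.add_one]; simp

lemma isHarmonic_J_H_div : IsHarmonic (J fun y => H 1 y / y) :=
  ((isHarmonic_J_bdiff_H_sq.add (isHarmonic_J_inv_pow (m := 2) (by norm_num))).rat_mul
    (1 / 2)).congr fun x hx => by rw [J_H_div hx.add_one]; push_cast; ring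

lemma isHarmonic_J_remMul : IsHarmonic (J remMul) :=
  (isHarmonic_J_H_div.sub (isHarmonic_J_inv_pow (m := 2) (by norm_num))).congr fun x _ => J_remMul x

lemma isHarmonic_J_remCube : IsHarmonic (J remCube) :=
  ((isHarmonic_J_H_div.rat_mul (-3)).add (isHarmonic_J_inv_pow (m := 2) (by norm_num))).congr
    fun x _ => by rw [J_remCube x]; simp

lemma continuousAt_bdiff {F : ℝ → ℝ} (hF : ∀ y, -1 < y → ContinuousAt F y) {y : ℝ} (hy : 0 < y) :
    ContinuousAt (bdiff F) y :=
  (hF y (by linarith)).sub ((hF (y - 1) (by linarith)).comp_of_eq (by fun_prop) rfl)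

lemma continuousAt_H_of_neg_one_lt {s : ℕ} (hs : 1 ≤ s) {y : ℝ} (hy : -1 < y) :
    ContinuousAt (H s) y := continuousAt_H hs (.of_pos (by linarith))

lemma continuousAt_inv_pow (m : ℕ) {y : ℝ} (hy : 0 < y) : ContinuousAt (fun y : ℝ => (y ^ m)⁻¹) y :=
  (continuousAt_id.pow m).inv₀ (pow_pos hy m).ne'

lemma continuousAt_H_div {s : ℕ} (hs : 1 ≤ s) {y : ℝ} (hy : 0 < y) :
    ContinuousAt (fun y : ℝ => H s y / y) y :=
  (continuousAt_H_of_neg_one_lt hs (by linarith)).div continuousAt_id hy.ne'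

lemma J_remMul_zero_mem : J remMul 0 ∈ zetaAlg :=
  isHarmonic_J_remMul.J_zero_mem decays_remMul fun _ hy =>
    (continuousAt_H_div le_rfl hy).add ((continuousAt_inv_pow 2 hy).const_mul _)

lemma J_remCube_zero_mem : J remCube 0 ∈ zetaAlg :=
  isHarmonic_J_remCube.J_zero_mem decays_remCube fun _ hy =>
    ((continuousAt_H_div le_rfl hy).const_mul _).add (continuousAt_inv_pow 2 hy)

lemma isHarmonic_J_bdiff_H_mul_H_two : IsHarmonic (J (bdiff fun y => H 1 y * H 2 y)) := by
  have h1 : IsHarmonic (H 1) := .H le_rfl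
  have h2 : IsHarmonic (H 2) := .H (by norm_num)
  have h3 : IsHarmonic (H 3) := .H (by norm_num)
  refine .of_mul (((((h1.mul h2).rat_mul 2).add h3).sub (h1.const_mul (zetaValue_mem le_rfl))).add
    (isHarmonic_J_remMul.sub (.const J_remMul_zero_mem))) fun x hx => ?_
  rw [mul_J_bdiff_H_mul_H_two hx.add_one]
  push_cast
  ring

lemma isHarmonic_J_bdiff_H_cube : IsHarmonic (J (bdiff fun y => H 1 y ^ 3)) := by
  have h1 : IsHarmonic (H 1) := .H le_rfl
  have h2 : IsHarmonic (H 2) := .H (by norm_num)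
  have h3 : IsHarmonic (H 3) := .H (by norm_num)
  refine .of_mul (((((((h1.pow 3).rat_mul (2 / 3)).add (h1.mul h2)).add
    (h1.const_mul (zetaValue_mem le_rfl))).add (h3.rat_mul (1 / 3))).rat_mul 3).add
    ((h1.pow 3).add (isHarmonic_J_remCube.sub (.const J_remCube_zero_mem)))) fun x hx => ?_
  rw [mul_J_bdiff_H_cube hx.add_one, D_H_sq hx.add_one]
  push_cast
  ring

lemma isHarmonic_J_remSqMul : IsHarmonic (J remSqMul) :=
  ((isHarmonic_J_bdiff_H_cube.rat_mul (1 / 3)).add ((isHarmonic_J_bdiff_H_mul_H_two.rat_mul (-1)).add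
    ((isHarmonic_J_inv_pow (m := 3) (by norm_num)).rat_mul (-1 / 3)))).congr
    fun x _ => by rw [J_remSqMul x]; push_cast; ring

lemma J_remSqMul_zero_mem : J remSqMul 0 ∈ zetaAlg := by
  refine isHarmonic_J_remSqMul.J_zero_mem decays_remSqMul fun y hy => ?_
  have hc : ∀ z, -1 < z → ContinuousAt (H 1) z := fun z hz => continuousAt_H_of_neg_one_lt le_rfl hz
  have hc2 : ∀ z, -1 < z → ContinuousAt (H 2) z :=
    fun z hz => continuousAt_H_of_neg_one_lt (by norm_num) hz
  exact ((continuousAt_bdiff (fun z hz => (hc z hz).pow 3) hy).const_mul _).add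
    (((continuousAt_bdiff (fun z hz => (hc z hz).mul (hc2 z hz)) hy).const_mul _).add
      ((continuousAt_inv_pow 3 hy).const_mul _))

lemma isHarmonic_J_bdiff_H_sq_mul_H_two :
    IsHarmonic (J (bdiff fun y => H 1 y ^ 2 * H 2 y)) := by
  have h1 : IsHarmonic (H 1) := .H le_rfl
  have h2 : IsHarmonic (H 2) := .H (by norm_num)
  have h3 : IsHarmonic (H 3) := .H (by norm_num)
  have h4 : IsHarmonic (H 4) := .H (by norm_num)
  refine .of_mul ((((((((((h1.pow 2).mul h2).add (h1.mul h3)).add ((h2.pow 2).rat_mul (1 / 2))).add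
    (h4.rat_mul (1 / 2))).add (((h2.sub (h1.pow 2)).const_mul (zetaValue_mem le_rfl)).rat_mul
    (1 / 2))).sub (h1.const_mul J_remMul_zero_mem)).rat_mul 2).add ((h1.pow 2).mul h2)).add
    (isHarmonic_J_remSqMul.sub (.const J_remSqMul_zero_mem))) fun x hx => ?_
  rw [mul_J_bdiff_H_sq_mul_H_two hx.add_one, D_H_mul_H_two hx.add_one]
  push_cast
  ring

/-! ### Summation by parts and partial fractions -/

/-- The algebra over `ℚ` generated by the functions `H s`, `s ≥ 1`. -/
noncomputable def polyAlg : Subalgebra ℚ (ℝ → ℝ) :=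
  Algebra.adjoin ℚ {f | ∃ s, 1 ≤ s ∧ f = H s}

lemma H_mem_polyAlg {s : ℕ} (hs : 1 ≤ s) : H s ∈ polyAlg := Algebra.subset_adjoin ⟨s, hs, rfl⟩

lemma slow_of_mem_polyAlg {F : ℝ → ℝ} (hF : F ∈ polyAlg) : Slow F := by
  induction hF using Algebra.adjoin_induction with
  | mem f hf => obtain ⟨s, hs, rfl⟩ := hf; exact Slow.H hs
  | algebraMap q => exact Slow.const _
  | add f g _ _ hf hg => exact hf.add hg
  | mul f g _ _ hf hg => exact hf.mul hg

lemma continuousAt_of_mem_polyAlg {F : ℝ → ℝ} (hF : F ∈ polyAlg) {y : ℝ} (hy : -1 < y) :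
    ContinuousAt F y := by
  induction hF using Algebra.adjoin_induction with
  | mem f hf => obtain ⟨s, hs, rfl⟩ := hf; exact continuousAt_H_of_neg_one_lt hs hy
  | algebraMap q => exact continuousAt_const
  | add f g _ _ hf hg => exact hf.add hg
  | mul f g _ _ hf hg => exact hf.mul hg

/-- `1/(n+i) - 1/(n+i+1)`. -/
noncomputable def invDiff (i n : ℕ) : ℝ := ((n : ℝ) + i)⁻¹ - ((n : ℝ) + i + 1)⁻¹

lemma invDiff_succ (i n : ℕ) :
    invDiff i (n + 1) = ((n : ℝ) + 1 + i)⁻¹ * ((n : ℝ) + 1 + i + 1)⁻¹ := by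
  rw [invDiff]
  push_cast
  field_simp
  ring

/-- The sum of `F(n + α) (1/(n+i) - 1/(n+i+1))` over `n ≥ 1`. -/
noncomputable def telSum (F : ℝ → ℝ) (i : ℕ) (α : ℝ) : ℝ :=
  F α / (1 + i) + (J (bdiff F) (α - i)
    - ∑ n ∈ Finset.range i, bdiff F (n + 1 + (α - i)) / (n + 1))

/-- Summation by parts gives `F(α)/(1+i) + ∑ ΔF(n+α)/(n+i)`, and shifting `n` by `i` identifies the
sum with `J(ΔF)(α-i)` minus its first `i` terms. Only the definition of `ΔF` is used, no recurrence,
so the identity holds for every real `α`: any default value at a pole cancels. -/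
lemma Slow.hasSum_telSum {F : ℝ → ℝ} (hF : Slow F) (i : ℕ) (α : ℝ) :
    HasSum (fun n : ℕ => F (n + 1 + α) * invDiff i (n + 1)) (telSum F i α) := by
  have hI : ∀ c : ℝ, (fun y : ℝ => (y + c)⁻¹) =O[atTop] fun y => y ^ (-1 : ℝ) :=
    isBigO_rpow_comp_add isBigO_inv_rpow
  have hFα : (fun y => F (y + α)) =O[atTop] fun y => y ^ (1 / 2 : ℝ) :=
    isBigO_rpow_comp_add (hF.1 _ (by norm_num)) α
  have hs : Summable fun n : ℕ => F (n + 1 + α) * invDiff i (n + 1) := by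
    have h1 := isBigO_rpow_mul (r := -(3 / 2)) hFα
      (isBigO_rpow_mul (r := -2) (hI i) (hI (i + 1)) (by norm_num)) (by norm_num)
    refine (summable_comp_natCast_add h1 0).congr fun n => ?_
    rw [invDiff_succ, add_zero, add_assoc ((n : ℝ) + 1) i 1]
  have hJ := (hasSum_nat_add_iff' i).2 (hF.decays_bdiff.hasSum_J (α - i))
  have hJ' : HasSum (fun n : ℕ => bdiff F (n + 1 + α) / (n + 1 + i))
      (J (bdiff F) (α - i) - ∑ n ∈ Finset.range i, bdiff F (n + 1 + (α - i)) / (n + 1)) := by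
    refine hJ.congr_fun fun n => ?_
    push_cast
    rw [show (n : ℝ) + i + 1 + (α - i) = n + 1 + α by ring, add_right_comm (n : ℝ) 1 (i : ℝ)]
  have hG : Tendsto (fun n : ℕ => -(F (n + α) / (n + 1 + i))) atTop (𝓝 0) := by
    have h1 := isBigO_rpow_mul (r := -(1 / 2)) hFα (hI (1 + i)) (by norm_num)
    have h2 := (h1.trans_tendsto (tendsto_rpow_neg_atTop (by norm_num))).comp
      (tendsto_natCast_atTop_atTop (R := ℝ))
    have h3 := h2.neg
    rw [neg_zero] at h3
    refine h3.congr fun n => ?_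
    simp [div_eq_mul_inv, add_assoc]
  have hT := hasSum_of_summable_of_telescoping
    (G := fun n : ℕ => -(F (n + α) / (n + 1 + i))) (hs.sub hJ'.summable) (fun n => ?_) hG
  · convert hT.add hJ' using 1
    · funext n
      ring
    · simp [telSum]
  · rw [invDiff_succ, bdiff]
    push_cast
    rw [show (n : ℝ) + 1 + α - 1 = n + α by ring]
    field_simp
    ring

/-- `g` is, at positive integers, a rational combination of the `invDiff i`, `i < N`. -/
def Telescopes (N : ℕ) (g : ℕ → ℝ) : Prop :=
  ∃ d : ℕ → ℚ, ∀ n : ℕ, 0 < n → g n = ∑ i ∈ Finset.range N, (d i : ℝ) * invDiff i n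

lemma Telescopes.sub {N : ℕ} {f g : ℕ → ℝ} (hf : Telescopes N f) (hg : Telescopes N g) :
    Telescopes N fun n => f n - g n := by
  obtain ⟨c, hc⟩ := hf
  obtain ⟨d, hd⟩ := hg
  refine ⟨fun i => c i - d i, fun n hn => ?_⟩
  simp only [hc n hn, hd n hn, ← Finset.sum_sub_distrib, Rat.cast_sub, sub_mul]

lemma Telescopes.rat_mul {N : ℕ} {f : ℕ → ℝ} (hf : Telescopes N f) (q : ℚ) :
    Telescopes N fun n => q * f n := by
  obtain ⟨c, hc⟩ := hf
  refine ⟨fun i => q * c i, fun n hn => ?_⟩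
  simp only [hc n hn, Finset.mul_sum, Rat.cast_mul, mul_assoc]

lemma Telescopes.congr {N : ℕ} {f g : ℕ → ℝ} (hf : Telescopes N f) (h : ∀ n, 0 < n → g n = f n) :
    Telescopes N g := by
  obtain ⟨c, hc⟩ := hf
  exact ⟨c, fun n hn => (h n hn).trans (hc n hn)⟩

lemma telescopes_inv_sub_inv_add {N a : ℕ} (ha : a ≤ N) :
    Telescopes N fun n => (n : ℝ)⁻¹ - ((n : ℝ) + a)⁻¹ := by
  refine ⟨fun i => if i < a then 1 else 0, fun n _ => ?_⟩
  have h1 : ∀ b : ℕ, ∑ i ∈ Finset.range b, invDiff i n = (n : ℝ)⁻¹ - ((n : ℝ) + b)⁻¹ := fun b => by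
    induction b with
    | zero => simp
    | succ b ih =>
      rw [Finset.sum_range_succ, ih, invDiff]
      push_cast
      ring
  simp only [← h1 a]
  rw [← Finset.sum_subset (Finset.range_subset_range.2 ha)]
  · refine Finset.sum_congr rfl fun i hi => ?_
    simp [Finset.mem_range.1 hi]
  · intro i _ hi
    simp [Finset.mem_range.not.1 hi]

/-- Since `b - a = (n+b) - (n+a)`, the product over `s` is `(b-a)^{-1}` times the difference of the
products with `b` and with `a` removed; this descends to two factors. -/
lemma telescopes_prod_inv {N : ℕ} (s : Finset ℕ) (hs : ∀ j ∈ s, j ≤ N) (hc : 2 ≤ s.card) :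
    Telescopes N fun n => ∏ j ∈ s, ((n : ℝ) + j)⁻¹ := by
  induction s using Finset.strongInduction with
  | H s ih =>
    obtain ⟨a, ha, b, hb, hab⟩ := Finset.one_lt_card.1 hc
    have hne : (b : ℝ) - a ≠ 0 := sub_ne_zero.2 (by exact_mod_cast hab.symm)
    rcases hc.eq_or_lt with h2 | h3
    · have hs2 : s = {a, b} := by
        refine (Finset.eq_of_subset_of_card_le ?_ ?_).symm
        · simp [Finset.insert_subset_iff, ha, hb]
        · rw [Finset.card_pair hab, ← h2]
      refine (((telescopes_inv_sub_inv_add (hs b hb)).sub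
        (telescopes_inv_sub_inv_add (hs a ha))).rat_mul ((b : ℚ) - a)⁻¹).congr fun n hn => ?_
      have hn : (0 : ℝ) < n := by exact_mod_cast hn
      rw [hs2, Finset.prod_pair hab]
      push_cast
      field_simp
      ring
    · refine (((ih (s.erase b) (Finset.erase_ssubset hb)
        (fun j hj => hs j (Finset.mem_of_mem_erase hj))
        (by rw [Finset.card_erase_of_mem hb]; omega)).sub
        (ih (s.erase a) (Finset.erase_ssubset ha) (fun j hj => hs j (Finset.mem_of_mem_erase hj))
        (by rw [Finset.card_erase_of_mem ha]; omega))).rat_mul ((b : ℚ) - a)⁻¹).congr fun n hn => ?_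
      have hn : (0 : ℝ) < n := by exact_mod_cast hn
      have e1 := Finset.mul_prod_erase s (fun j => ((n : ℝ) + j)⁻¹) ha
      have e2 := Finset.mul_prod_erase s (fun j => ((n : ℝ) + j)⁻¹) hb
      have e3 : ∏ j ∈ s.erase a, ((n : ℝ) + j)⁻¹ = (n + a) * ∏ j ∈ s, ((n : ℝ) + j)⁻¹ := by
        rw [← e1]; field_simp
      have e4 : ∏ j ∈ s.erase b, ((n : ℝ) + j)⁻¹ = (n + b) * ∏ j ∈ s, ((n : ℝ) + j)⁻¹ := by
        rw [← e2]; field_simp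
      simp only [e3, e4]
      push_cast
      field_simp
      ring

lemma factorial_mul_choose_eq_prod (k r n : ℕ) :
    (k.factorial : ℝ) * ((n + k + r).choose k : ℝ)
      = ∏ j ∈ Finset.Icc (r + 1) (r + k), ((n : ℝ) + j) := by
  have h1 := Nat.ascFactorial_eq_factorial_mul_choose (n + r) k
  rw [Nat.ascFactorial_eq_prod_range] at h1
  rw [show n + k + r = n + r + k by ring, ← Nat.cast_mul, ← h1,
    show Finset.Icc (r + 1) (r + k) = Finset.Ico (r + 1) (r + k + 1) from rfl,
    Finset.prod_Ico_eq_prod_range, show r + k + 1 - (r + 1) = k by omega]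
  push_cast
  refine Finset.prod_congr rfl fun j _ => by ring

/-- For `p = 0` the factors are `n + j` with `r < j ≤ r + k`, and `k ≥ 2` supplies two of them. For
`p = 1` the index `0` joins, distinct from the others. -/
lemma telescopes_inv_denom {k r p : ℕ} (hk : 2 ≤ k) (hp : p = 0 ∨ p = 1) :
    Telescopes (k + r) fun n => (denom p k r n)⁻¹ := by
  have hk0 : (k.factorial : ℝ) ≠ 0 := by exact_mod_cast k.factorial_ne_zero
  have hchoose : ∀ n : ℕ, ((n + k + r).choose k : ℝ)⁻¹
      = k.factorial * ∏ j ∈ Finset.Icc (r + 1) (r + k), ((n : ℝ) + j)⁻¹ := fun n => by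
    rw [Finset.prod_inv_distrib, ← factorial_mul_choose_eq_prod, mul_inv, mul_inv_cancel_left₀ hk0]
  have hcard : (Finset.Icc (r + 1) (r + k)).card = k := by simp
  rcases hp with rfl | rfl
  · refine ((telescopes_prod_inv (N := k + r) (Finset.Icc (r + 1) (r + k))
      (fun j hj => by have := Finset.mem_Icc.1 hj; omega) (by omega)).rat_mul
      (k.factorial : ℚ)).congr fun n _ => ?_
    rw [denom, pow_zero, one_mul, hchoose]
    simp
  · refine ((telescopes_prod_inv (N := k + r) (insert 0 (Finset.Icc (r + 1) (r + k)))
      (fun j hj => by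
        rcases Finset.mem_insert.1 hj with rfl | hj
        · omega
        · have := Finset.mem_Icc.1 hj
          omega)
      (by rw [Finset.card_insert_of_notMem (by simp)]; omega)).rat_mul
      (k.factorial : ℚ)).congr fun n _ => ?_
    rw [denom, pow_one, mul_inv, hchoose, Finset.prod_insert (by simp)]
    simp
    ring

/-! ### The generators and the closed form -/

/-- The parameters `α` at which all generators are defined. -/
def IsRegular (k r : ℕ) (α : ℝ) : Prop := (k : ℝ) < α ∧ ∀ j : ℕ, j < k + r → α ≠ (j : ℝ)

lemma IsRegular.nonPole {k r : ℕ} {α : ℝ} (h : IsRegular k r α) {i : ℕ} (hi : i < k + r) :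
    NonPole (α - i) := fun j hj => by
  rcases le_or_gt j i with hji | hji
  · refine h.2 (i - j) (by omega) ?_
    rw [Nat.cast_sub hji]
    linarith
  · have h1 : (i : ℝ) < j := by exact_mod_cast hji
    have h2 := h.1
    have h3 : (0 : ℝ) ≤ k := k.cast_nonneg
    linarith

/-- The algebra over `ℚ` generated by the generators, as functions of the regular parameter. -/
noncomputable def genAlg (k r : ℕ) : Subalgebra ℚ ({α : ℝ // IsRegular k r α} → ℝ) :=
  Algebra.adjoin ℚ (Set.range fun i α => generator (k + r) α.1 i)

/-- Membership in an algebra of functions of `α`, rather than of numbers, is what yields one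
polynomial for all regular parameters. -/
lemma exists_polynomial_of_mem_genAlg {k r : ℕ} {f : ℝ → ℝ}
    (hf : (fun α : {α : ℝ // IsRegular k r α} => f α) ∈ genAlg k r) :
    ∃ P : MvPolynomial ((Fin (k + r + 1) × ℕ) ⊕ ℕ) ℚ,
      ∀ α : ℝ, IsRegular k r α → f α = MvPolynomial.aeval (generator (k + r) α) P := by
  rw [genAlg, Algebra.adjoin_range_eq_range_aeval] at hf
  obtain ⟨P, hP⟩ := hf
  refine ⟨P, fun α hα => ?_⟩
  have h1 := congrFun hP ⟨α, hα⟩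
  simp only at h1
  rw [← h1]
  exact MvPolynomial.comp_aeval_apply _
    (Pi.evalAlgHom ℚ (fun _ : {α : ℝ // IsRegular k r α} => ℝ) ⟨α, hα⟩) P

lemma H_mem_genAlg {k r i s : ℕ} (hi : i ≤ k + r) (hs : 1 ≤ s) :
    (fun α : {α : ℝ // IsRegular k r α} => H s (α - i)) ∈ genAlg k r := by
  obtain ⟨s, rfl⟩ := Nat.exists_eq_add_of_le' hs
  exact Algebra.subset_adjoin ⟨Sum.inl (⟨i, by omega⟩, s), by simp [generator]⟩

lemma const_mem_genAlg {k r : ℕ} {c : ℝ} (hc : c ∈ zetaAlg) :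
    (fun _ : {α : ℝ // IsRegular k r α} => c) ∈ genAlg k r := by
  induction hc using Algebra.adjoin_induction with
  | mem c hc =>
    obtain ⟨t, rfl⟩ := hc
    exact Algebra.subset_adjoin ⟨Sum.inr t, by simp [generator]⟩
  | algebraMap q => exact (genAlg k r).algebraMap_mem q
  | add f g _ _ hf hg => exact (genAlg k r).add_mem hf hg
  | mul f g _ _ hf hg => exact (genAlg k r).mul_mem hf hg

/-- The reciprocal is `H_{α-i} - H_{α-i-1}`, which uses the generator of index `i + 1`; hence the
strict bound on `i`. -/
lemma inv_mem_genAlg {k r i : ℕ} (hi : i < k + r) :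
    (fun α : {α : ℝ // IsRegular k r α} => (α.1 - i)⁻¹) ∈ genAlg k r := by
  have h := (genAlg k r).sub_mem (H_mem_genAlg hi.le le_rfl)
    (H_mem_genAlg (i := i + 1) (by omega) le_rfl)
  convert h using 1
  funext α
  have h1 := H_sub_one le_rfl (α.2.nonPole hi)
  simp only [Pi.sub_apply]
  push_cast
  rw [← sub_sub, h1, pow_one]
  ring

lemma IsHarmonic.mem_genAlg {f : ℝ → ℝ} (hf : IsHarmonic f) {k r i : ℕ} (hi : i < k + r) :
    (fun α : {α : ℝ // IsRegular k r α} => f (α - i)) ∈ genAlg k r := by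
  obtain ⟨g, hg, h⟩ := hf
  rw [show (fun α : {α : ℝ // IsRegular k r α} => f (α - i)) = fun α => g (α.1 - i) from
    funext fun α => h _ (α.2.nonPole hi)]
  clear h
  induction hg using Algebra.adjoin_induction with
  | mem f hf =>
    rcases hf with (⟨s, hs, rfl⟩ | ⟨c, hc, rfl⟩) | rfl
    · exact H_mem_genAlg hi.le hs
    · exact const_mem_genAlg hc
    · exact inv_mem_genAlg hi
  | algebraMap q => exact (genAlg k r).algebraMap_mem q
  | add f g _ _ hf hg => exact (genAlg k r).add_mem hf hg
  | mul f g _ _ hf hg => exact (genAlg k r).mul_mem hf hg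

lemma mem_genAlg_of_mem_polyAlg {F : ℝ → ℝ} (hF : F ∈ polyAlg) {k r i : ℕ} (hi : i ≤ k + r) :
    (fun α : {α : ℝ // IsRegular k r α} => F (α - i)) ∈ genAlg k r := by
  induction hF using Algebra.adjoin_induction with
  | mem f hf => obtain ⟨s, hs, rfl⟩ := hf; exact H_mem_genAlg hi hs
  | algebraMap q => exact (genAlg k r).algebraMap_mem q
  | add f g _ _ hf hg => exact (genAlg k r).add_mem hf hg
  | mul f g _ _ hf hg => exact (genAlg k r).mul_mem hf hg

lemma telSum_mem_genAlg {F : ℝ → ℝ} (hF : F ∈ polyAlg) (hJ : IsHarmonic (J (bdiff F)))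
    {k r i : ℕ} (hi : i < k + r) :
    (fun α : {α : ℝ // IsRegular k r α} => telSum F i α) ∈ genAlg k r := by
  have hrat : ∀ q : ℚ, (fun _ : {α : ℝ // IsRegular k r α} => (q : ℝ)) ∈ genAlg k r :=
    fun q => const_mem_genAlg (ratCast_mem_zetaAlg q)
  have h1 := (genAlg k r).mul_mem (mem_genAlg_of_mem_polyAlg hF (Nat.zero_le _))
    (hrat (1 + (i : ℚ))⁻¹)
  have h2 : ∀ n ∈ Finset.range i, (fun α : {α : ℝ // IsRegular k r α} =>
      bdiff F (n + 1 + (α - i)) / (n + 1)) ∈ genAlg k r := by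
    intro n hn
    have hn := Finset.mem_range.1 hn
    -- Because `n < i`, both arguments of `F` in the difference have the form `α - j` with `0 ≤ j ≤
    -- i`.
    have h3 := (genAlg k r).mul_mem ((genAlg k r).sub_mem
      (mem_genAlg_of_mem_polyAlg hF (i := i - (n + 1)) (by omega))
      (mem_genAlg_of_mem_polyAlg hF (i := i - n) (by omega))) (hrat ((n : ℚ) + 1)⁻¹)
    convert h3 using 1
    funext α
    simp only [Pi.mul_apply, Pi.sub_apply, bdiff]
    rw [Nat.cast_sub (by omega), Nat.cast_sub (by omega)]
    push_cast
    rw [div_eq_mul_inv]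
    ring_nf
  have h4 := (genAlg k r).add_mem h1 ((genAlg k r).sub_mem (hJ.mem_genAlg hi)
    ((genAlg k r).sum_mem h2))
  convert h4 using 1
  funext α
  simp [telSum, div_eq_mul_inv]

/-- Continuity is read off the series, where `F` is evaluated only at positive points; the
individual terms of `telSum` may have poles at integers `a`. -/
lemma tendsto_telSum {F : ℝ → ℝ} (hF : F ∈ polyAlg) (i : ℕ) {a : ℝ} (ha : 0 < a) :
    Tendsto (telSum F i) (𝓝 a) (𝓝 (telSum F i a)) := by
  have hs := slow_of_mem_polyAlg hF
  have h := tendsto_tsum_comp_add_mul (φ := F) (p := 1 / 2) (q := -2)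
    (w := fun n => invDiff i (n + 1)) (x₀ := a) (hs.1 _ (by norm_num)) (fun n => ?_) (by norm_num)
    fun n => continuousAt_of_mem_polyAlg hF (by linarith [n.cast_nonneg (α := ℝ)])
  · have e : telSum F i = fun x => ∑' n : ℕ, F (n + 1 + x) * invDiff i (n + 1) :=
      funext fun x => (hs.hasSum_telSum i x).tsum_eq.symm
    rwa [e]
  · rw [invDiff_succ, abs_of_pos (by positivity), Real.rpow_neg (by positivity),
      show (2 : ℝ) = ((2 : ℕ) : ℝ) by norm_num, Real.rpow_natCast, sq, mul_inv]
    have hi : (0 : ℝ) ≤ i := i.cast_nonneg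
    exact mul_le_mul (inv_anti₀ (by positivity) (by linarith))
      (inv_anti₀ (by positivity) (by linarith)) (by positivity) (by positivity)

lemma eventually_isRegular {k r a : ℕ} (ha : k < a) :
    ∀ᶠ t : ℝ in 𝓝[≠] 0, IsRegular k r (t + a) := by
  have h1 : ∀ᶠ t : ℝ in 𝓝[≠] 0, (k : ℝ) - a < t :=
    nhdsWithin_le_nhds (lt_mem_nhds (sub_neg.2 (by exact_mod_cast ha)))
  have h2 : ∀ᶠ t : ℝ in 𝓝[≠] 0, ∀ j ∈ Finset.range (k + r), NonPole (t + ((a - j : ℤ) : ℝ)) := by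
    rw [eventually_all_finset]
    exact fun j _ => eventually_nonPole_add_int _
  filter_upwards [h1, h2] with t ht1 ht2
  refine ⟨by linarith, fun j hj h => (ht2 j (Finset.mem_range.2 hj)).ne_zero ?_⟩
  push_cast
  linarith

lemma hasLaurent_generator (N a : ℕ) (i : (Fin (N + 1) × ℕ) ⊕ ℕ) :
    HasLaurent fun t => generator N (t + a) i := by
  rcases i with ⟨i, s⟩ | t
  · refine (HasLaurent.H_add_int (s := s + 1) (by omega) ((a : ℤ) - (i : ℕ))).congr
      (Eventually.of_forall fun t => ?_)
    simp [generator, add_sub_assoc]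
  · simpa [generator] using HasLaurent.const (zetaValue_mem (s := t + 2) (by omega))

lemma hasLaurent_aeval_generator (N a : ℕ) (P : MvPolynomial ((Fin (N + 1) × ℕ) ⊕ ℕ) ℚ) :
    HasLaurent fun t => MvPolynomial.aeval (generator N (t + a)) P := by
  have h1 : MvPolynomial.aeval (fun i t => generator N (t + a) i) P ∈ laurentAlg := by
    have h2 : Algebra.adjoin ℚ (Set.range fun i t => generator N (t + (a : ℝ)) i) ≤ laurentAlg := by
      refine Algebra.adjoin_le ?_
      rintro _ ⟨i, rfl⟩
      exact hasLaurent_generator N a i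
    refine h2 ?_
    rw [Algebra.adjoin_range_eq_range_aeval]
    exact ⟨P, rfl⟩
  refine (mem_laurentAlg.1 h1).congr (Eventually.of_forall fun t => ?_)
  exact MvPolynomial.comp_aeval_apply _ (Pi.evalAlgHom ℚ (fun _ : ℝ => ℝ) t) P

theorem hasClosedForm_of_isHarmonic {k r p : ℕ} (hk : 2 ≤ k) (hp : p = 0 ∨ p = 1) {F : ℝ → ℝ}
    (hF : F ∈ polyAlg) (hJ : IsHarmonic (J (bdiff F))) :
    HasClosedForm k r fun α n => F (n + α) / denom p k r n := by
  obtain ⟨d, hd⟩ := telescopes_inv_denom (r := r) hk hp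
  simp only at hd
  have hs := slow_of_mem_polyAlg hF
  have hsum : ∀ α : ℝ, HasSum (fun n : ℕ => F ((n + 1 : ℕ) + α) / denom p k r (n + 1))
      (∑ i ∈ Finset.range (k + r), (d i : ℝ) * telSum F i α) := by
    intro α
    have h1 := hasSum_sum (s := Finset.range (k + r)) fun i _ =>
      (hs.hasSum_telSum i α).mul_left (d i : ℝ)
    refine h1.congr_fun fun n => ?_
    rw [div_eq_mul_inv, hd (n + 1) n.succ_pos, Finset.mul_sum]
    refine Finset.sum_congr rfl fun i _ => ?_
    push_cast
    ring
  obtain ⟨P, hP⟩ := exists_polynomial_of_mem_genAlg (k := k) (r := r)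
    (f := fun α => ∑ i ∈ Finset.range (k + r), (d i : ℝ) * telSum F i α) (by
      have h1 := (genAlg k r).sum_mem (t := Finset.range (k + r)) fun i hi =>
        (genAlg k r).mul_mem (const_mem_genAlg (ratCast_mem_zetaAlg (d i)))
          (telSum_mem_genAlg hF hJ (Finset.mem_range.1 hi))
      convert h1 using 1
      funext α
      simp)
  refine ⟨⟨P, fun α h1 h2 => ?_⟩, fun a ha => ?_⟩
  · rw [← hP α ⟨h1, h2⟩]
    exact hsum α
  · have ha0 : (0 : ℝ) < a := by exact_mod_cast (by omega : 0 < a)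
    -- Near `a` every parameter other than `a` itself is regular, so there the polynomial equals the
    -- sum, which is continuous at `a`.
    have hlim : Tendsto (fun t : ℝ => MvPolynomial.aeval (generator (k + r) (t + a)) P) (𝓝[≠] 0)
        (𝓝 (∑ i ∈ Finset.range (k + r), (d i : ℝ) * telSum F i a)) := by
      have h1 : Tendsto (fun α => ∑ i ∈ Finset.range (k + r), (d i : ℝ) * telSum F i α) (𝓝 (a : ℝ))
          (𝓝 (∑ i ∈ Finset.range (k + r), (d i : ℝ) * telSum F i a)) :=
        tendsto_finsetSum _ fun i _ => (tendsto_telSum hF i ha0).const_mul _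
      have h2 : Tendsto (fun t : ℝ => t + a) (𝓝[≠] 0) (𝓝 (a : ℝ)) := by
        have h3 : Tendsto (fun t : ℝ => t + a) (𝓝 0) (𝓝 (0 + a)) :=
          (continuous_add_const (a : ℝ)).tendsto 0
        rw [zero_add] at h3
        exact h3.mono_left nhdsWithin_le_nhds
      refine (h1.comp h2).congr' ?_
      filter_upwards [eventually_isRegular (r := r) ha] with t ht
      exact hP _ ht
    -- The poles of the generators at `α = a` must cancel, leaving the constant Laurent coefficient.
    have hmem := (hasLaurent_aeval_generator (k + r) a P).mem_of_tendsto hlim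
    rw [zetaAlg, Algebra.adjoin_range_eq_range_aeval] at hmem
    obtain ⟨Q, hQ⟩ := hmem
    refine ⟨Q, ?_⟩
    have h4 := hsum a
    rw [← hQ] at h4
    exact h4

end ShiftedHarmonic

theorem theorem3p1 (k r m p : ℕ) (hr : 0 < r) (hrk : r < k) (hm : 0 < m) (hp : p = 0 ∨ p = 1) :
    ShiftedHarmonic.HasClosedForm k r (ShiftedHarmonic.WTerm 1 k r p m) ∧
    ShiftedHarmonic.HasClosedForm k r (ShiftedHarmonic.WTerm 2 k r p 1) ∧
    ShiftedHarmonic.HasClosedForm k r (ShiftedHarmonic.WTerm 3 k r p 1) ∧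
    ShiftedHarmonic.HasClosedForm k r (ShiftedHarmonic.mixedTerm 1 k r p) ∧
    ShiftedHarmonic.HasClosedForm k r (ShiftedHarmonic.mixedTerm 2 k r p) := by
  have hk : 2 ≤ k := by omega
  have h1 := ShiftedHarmonic.H_mem_polyAlg (le_refl 1)
  have h2 := ShiftedHarmonic.H_mem_polyAlg (show 1 ≤ 2 by norm_num)
  refine ⟨?_, ?_, ?_, ?_, ?_⟩
  · exact ShiftedHarmonic.hasClosedForm_of_isHarmonic (F := fun y => ShiftedHarmonic.H m y ^ 1) hk hp
      (ShiftedHarmonic.polyAlg.pow_mem (ShiftedHarmonic.H_mem_polyAlg hm) 1)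
      (by simpa only [pow_one] using ShiftedHarmonic.isHarmonic_J_bdiff_H hm)
  · exact ShiftedHarmonic.hasClosedForm_of_isHarmonic (F := fun y => ShiftedHarmonic.H 1 y ^ 2) hk hp
      (ShiftedHarmonic.polyAlg.pow_mem h1 2) ShiftedHarmonic.isHarmonic_J_bdiff_H_sq
  · exact ShiftedHarmonic.hasClosedForm_of_isHarmonic (F := fun y => ShiftedHarmonic.H 1 y ^ 3) hk hp
      (ShiftedHarmonic.polyAlg.pow_mem h1 3) ShiftedHarmonic.isHarmonic_J_bdiff_H_cube
  · exact ShiftedHarmonic.hasClosedForm_of_isHarmonic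
      (F := fun y => ShiftedHarmonic.H 1 y ^ 1 * ShiftedHarmonic.H 2 y) hk hp
      (ShiftedHarmonic.polyAlg.mul_mem (ShiftedHarmonic.polyAlg.pow_mem h1 1) h2)
      (by simpa only [pow_one] using ShiftedHarmonic.isHarmonic_J_bdiff_H_mul_H_two)
  · exact ShiftedHarmonic.hasClosedForm_of_isHarmonic
      (F := fun y => ShiftedHarmonic.H 1 y ^ 2 * ShiftedHarmonic.H 2 y) hk hp
      (ShiftedHarmonic.polyAlg.mul_mem (ShiftedHarmonic.polyAlg.pow_mem h1 2) h2)
      ShiftedHarmonic.isHarmonic_J_bdiff_H_sq_mul_H_two
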